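/- Let $M$ be a smooth Hausdorff $4$-manifold with a smooth Lorentz metric $g$ of signature $(-,+,+,+)$ and Levi-Civita connection $\bar\nabla$. Let $m\in M$, fix a Lorentz-orthonormal basis of $T_mM$, and let $\mathcal O\subseteq T_mM$ be an open neighbourhood of $0$ that $\exp_m$ maps diffeomorphically onto an open neighbourhood $\mathcal U$ of $m$; identify $\mathcal U$ with $\mathcal O$, and carry $g$ and $\bar\nabla$ over to $\mathcal O$. On the manifold $T_mM$ let a smooth connection $\nabla$ (possibly with torsion) be given that is compatible with a smooth positive definite Riemannian metric $h$ on $T_mM$. All norms of tangent vectors are those of $h$. On $\mathcal O$ put $G(X,Y)=\nabla_XY-\bar\nabla_XY$ and $\|G_x\|=\sup_{\|X\|\le 1}\|G_x(X,X)\|$. Let $m_0,m_1\in\mathcal O$, $T>0$, and let $\gamma:[0,T]\to\mathcal O$ be a geodesic of $\nabla$ with $\gamma(0)=m_0$, $\gamma(T)=m_1$, such that $m_0$ and $m_1$ are not conjugate along $\gamma$ (no nontrivial Jacobi field along $\gamma$, i.e. solution of the linearized geodesic equation, vanishes at both ends) and $\gamma'(0)$ is time-like, $g_{m_0}(\gamma'(0),\gamma'(0))<0$.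 For a continuous curve $v:[0,1]\to T_{m_0}\mathcal O$ let $Sv$ be the $C^1$ curve on $[0,1]$ in $T_mM$, if it exists, with $Sv(0)=m_0$ and with $(Sv)'(t)$ parallel along $Sv$ (for $\nabla$) to $v(t)$ for all $t$; it is unique. For $\varepsilon>0$ let $U_\varepsilon$ be the closed ball of radius $\varepsilon$ about $0$ in $C^0([0,1],T_{m_0}\mathcal O)$. Call $(\varepsilon,C,W,\kappa)$ admissible if $\varepsilon>0$, $W$ is a bounded neighbourhood of $T\gamma'(0)$ (the initial vector of $s\mapsto\gamma(Ts)$), and for every $u\in U_\varepsilon$ the vector $\kappa(u)$ is the unique $a\in W$ with $S(u+a)(1)=m_1$, $\kappa(u)$ depends continuously on $u$, is time-like at $m_0$, and $\|\kappa(u)\|\le C$. (1) For every open set $U\supseteq\gamma([0,T])$ there is an admissible $(\varepsilon,C,W,\kappa)$ such that moreover all the curves $S(u+\kappa(u))$, $u\in U_\varepsilon$, lie in $U$. (2) Let $(\varepsilon,C,W,\kappa)$ be any admissible quadruple. Let $V\subseteq\mathcal O$ be a ball, or more generally any subset, that contains all the curves $S(u+\kappa(u))$, $u\in U_\varepsilon$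 (so in particular $m_0,m_1\in V$), and suppose that $\|G_x\|<\dfrac{\varepsilon}{(\varepsilon+C)^2}$ for all $x\in V$. Then there is a time-like geodesic $c:[0,T]\to M$ of the Levi-Civita connection of $g$ with $c(0)=m_0$ and $c(T)=m_1$. -/

import Mathlib

open Set Filter Topology
open scoped Manifold ContDiff

noncomputable section

/-- The model space `ℝ⁴`, with coordinates `X 0, X 1, X 2, X 3`. -/
abbrev E4 : Type := EuclideanSpace ℝ (Fin 4)

/-- The Minkowski product of signature `(-,+,+,+)`. -/
def minkowski (X Y : E4) : ℝ := -(X 0 * Y 0) + X 1 * Y 1 + X 2 * Y 2 + X 3 * Y 3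

/-! ### Metrics and connections on open subsets of `ℝ⁴` -/

/-- A field of bilinear forms on (an open subset of) `ℝ⁴`. -/
abbrev FormField : Type := E4 → E4 →L[ℝ] E4 →L[ℝ] ℝ

/-- A connection on the manifold `ℝ⁴`, given by its Christoffel map:
`∇_X Y = DY(X) + Γ(X, Y)`; see `covDeriv`. No symmetry in `X, Y` is asked for, so there may be
torsion. -/
abbrev ConnectionField : Type := E4 → E4 →L[ℝ] E4 →L[ℝ] E4

/-- The covariant derivative `(∇_X Y)(x)` of the connection with Christoffel map `Γ`. -/
def covDeriv (Γ : E4 → E4 → E4 → E4) (X Y : E4 → E4) (x : E4) : E4 :=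
  fderiv ℝ Y x (X x) + Γ x (X x) (Y x)

/-- The Koszul functional (Christoffel symbols of the first kind)
`Z ↦ ½ (∂_X g(Y, Z) + ∂_Y g(X, Z) - ∂_Z g(X, Y))` for constant `X, Y, Z`. -/
def koszul (g : FormField) (x X Y : E4) : E4 →L[ℝ] ℝ :=
  (1 / 2 : ℝ) • (fderiv ℝ g x X Y + fderiv ℝ g x Y X - ((fderiv ℝ g x).flip X).flip Y)

/-- The Christoffel map of the Levi-Civita connection of a nondegenerate symmetric `g`:
`g_x (christoffel g x X Y) = koszul g x X Y`. -/
def christoffel (g : FormField) (x X Y : E4) : E4 :=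
  (g x).inverse (koszul g x X Y)

/-- The defining property of the Levi-Civita Christoffel map where the form is nondegenerate. -/
theorem christoffel_spec (g : FormField) (x X Y Z : E4) (hx : (g x).IsInvertible) :
    g x (christoffel g x X Y) Z =
      1 / 2 * (fderiv ℝ g x X Y Z + fderiv ℝ g x Y X Z - fderiv ℝ g x Z X Y) := by
  obtain ⟨e, he⟩ := hx
  have h : g x (christoffel g x X Y) = koszul g x X Y := by
    unfold christoffel
    rw [← he, ContinuousLinearMap.inverse_equiv]
    simp
  rw [h]
  simp [koszul]

/-- A smooth positive definite Riemannian metric on `ℝ⁴`. -/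
structure IsRiemannianMetric (h : FormField) : Prop where
  smooth : ContDiff ℝ ∞ h
  symm : ∀ x X Y, h x X Y = h x Y X
  pos : ∀ x X, X ≠ 0 → 0 < h x X X

/-- The connection `Γ` is compatible with `h`:
`Z h(X, Y) = h(∇_Z X, Y) + h(X, ∇_Z Y)` (written out on constant fields `X, Y, Z`). -/
def IsMetricConnection (Γ : ConnectionField) (h : FormField) : Prop :=
  ∀ x X Y Z, fderiv ℝ h x Z X Y = h x (Γ x Z X) Y + h x X (Γ x Z Y)

/-- The norm of a tangent vector at `x` for the Riemannian metric `h`. -/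
def rnorm (h : FormField) (x X : E4) : ℝ := Real.sqrt (h x X X)

/-- The value `G_x(X, Y)` of the tensor `G(X, Y) = ∇_X Y - ∇̄_X Y`, where `∇` is the connection `Γ`
and `∇̄` is the Levi-Civita connection of `g`; see `gravTensor_eq`. -/
def gravTensor (Γ : ConnectionField) (g : FormField) (x X Y : E4) : E4 :=
  Γ x X Y - christoffel g x X Y

theorem gravTensor_eq (Γ : ConnectionField) (g : FormField) (X Y : E4 → E4) (x : E4) :
    gravTensor Γ g x (X x) (Y x) =
      covDeriv (fun x X Y => Γ x X Y) X Y x - covDeriv (christoffel g) X Y x := by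
  simp [gravTensor, covDeriv]

/-- `‖G_x‖ = sup {‖G_x(X, X)‖ : ‖X‖ ≤ 1}`, with the norms of the Riemannian metric `h`. -/
def gravNorm (Γ : ConnectionField) (g h : FormField) (x : E4) : ℝ :=
  sSup ((fun X => rnorm h x (gravTensor Γ g x X X)) '' {X | rnorm h x X ≤ 1})

/-- At the parameter `t`, relative to the parameter set `J`, the curve `y` has velocity `v` and
satisfies the geodesic equation `y'' + Γ_y(y', y') = 0`. -/
def SolvesGeodesicEq (Γ : E4 → E4 → E4 → E4) (J : Set ℝ) (y v : ℝ → E4) (t : ℝ) : Prop :=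
  HasDerivWithinAt y (v t) J t ∧ HasDerivWithinAt v (-Γ (y t) (v t) (v t)) J t

/-- `γ : [0, T] → ℝ⁴` is a geodesic of the connection `Γ`, with velocity `γ'`. -/
def IsFrameGeodesic (Γ : ConnectionField) (T : ℝ) (γ γ' : ℝ → E4) : Prop :=
  ∀ t ∈ Icc 0 T, SolvesGeodesicEq (fun x X Y => Γ x X Y) (Icc 0 T) γ γ' t

/-- `J`, with derivative `J'`, is a Jacobi field along the geodesic `γ : [0, T] → ℝ⁴`: it solves
the linearization along `γ` of the geodesic equation `γ'' + Γ_γ(γ', γ') = 0`. (For connections with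
torsion too, these are the variation fields of the variations of `γ` through geodesics.) -/
def IsJacobiField (Γ : ConnectionField) (T : ℝ) (γ γ' J J' : ℝ → E4) : Prop :=
  ∀ t ∈ Icc 0 T, HasDerivWithinAt J (J' t) (Icc 0 T) t ∧
    HasDerivWithinAt J'
      (-(fderiv ℝ Γ (γ t) (J t) (γ' t) (γ' t) + Γ (γ t) (J' t) (γ' t) + Γ (γ t) (γ' t) (J' t)))
      (Icc 0 T) t

/-- The endpoints of `γ : [0, T] → ℝ⁴` are not conjugate along `γ`: no nontrivial Jacobi field
along `γ` vanishes at both of them. -/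
def NotConjugateAlong (Γ : ConnectionField) (T : ℝ) (γ γ' : ℝ → E4) : Prop :=
  ∀ J J' : ℝ → E4, IsJacobiField Γ T γ γ' J J' → J 0 = 0 → J T = 0 → ∀ t ∈ Icc 0 T, J t = 0

/-! ### The Cartan development operator -/

/-- `P t` is the parallel translation from `p 0` to `p t` along the curve `p : [0, 1] → ℝ⁴` with
velocity `p'`: for each vector `X`, the field `t ↦ P t X` satisfies `D/dt (P t X) = 0` and starts
at `X`. -/
def IsParallelTranslation (Γ : ConnectionField) (p p' : ℝ → E4) (P : ℝ → E4 →L[ℝ] E4) : Prop :=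
  P 0 = ContinuousLinearMap.id ℝ E4 ∧
    ∀ t ∈ Icc (0 : ℝ) 1, HasDerivWithinAt P (-((Γ (p t) (p' t)).comp (P t))) (Icc 0 1) t

/-- `p = S v` on `[0, 1]`: the `C¹` curve with `p 0 = x₀` whose velocity `p' t` is parallel along
`p` to the vector `v t` of the tangent space at `x₀`. -/
def IsDevelopment (Γ : ConnectionField) (x₀ : E4) (v p : ℝ → E4) : Prop :=
  p 0 = x₀ ∧ ∃ P : ℝ → E4 →L[ℝ] E4,
    (∀ t ∈ Icc (0 : ℝ) 1, HasDerivWithinAt p (P t (v t)) (Icc 0 1) t) ∧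
    IsParallelTranslation Γ p (fun t => P t (v t)) P

/-- The curve `u + a : [0, 1] → T_{x₀}`, for `u ∈ C⁰([0, 1], T_{x₀})` and a constant vector `a`. -/
def shift (u : C(Icc (0 : ℝ) 1, E4)) (a : E4) (t : ℝ) : E4 := u (projIcc 0 1 zero_le_one t) + a

/-- The closed ball `U_ε` of radius `ε` about `0` in `C⁰([0, 1], T_{x₀})`, for the supremum norm
built from the norm of `h` on the tangent space at `x₀`. -/
def curveBall (h : FormField) (x₀ : E4) (ε : ℝ) : Set C(Icc (0 : ℝ) 1, E4) :=
  {u | ∀ t, rnorm h x₀ (u t) ≤ ε}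

/-- `S(u + a)` is defined on `[0, 1]` and `S(u + a)(1) = x₁`. -/
def DevelopsTo (Γ : ConnectionField) (x₀ x₁ : E4) (u : C(Icc (0 : ℝ) 1, E4)) (a : E4) : Prop :=
  ∃ p : ℝ → E4, IsDevelopment Γ x₀ (shift u a) p ∧ p 1 = x₁

/-- The numbers `ε > 0` and `C`, the neighbourhood `W` of the initial vector `X₀` and the map
`u ↦ κ u` are as follows: for each `u ∈ U_ε`, the vector `κ u` is the unique `a ∈ W` with
`S(u + a)(1) = x₁`; it depends continuously on `u`, lies inside the light cone of the Lorentz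
form `g` at `x₀`, and has norm at most `C`. -/
structure IsAdmissible (Γ : ConnectionField) (g h : FormField) (x₀ x₁ X₀ : E4)
    (ε C : ℝ) (W : Set E4) (κ : C(Icc (0 : ℝ) 1, E4) → E4) : Prop where
  eps_pos : 0 < ε
  nhds : W ∈ 𝓝 X₀
  bounded : Bornology.IsBounded W
  mem : ∀ u ∈ curveBall h x₀ ε, κ u ∈ W
  develops : ∀ u ∈ curveBall h x₀ ε, DevelopsTo Γ x₀ x₁ u (κ u)
  unique : ∀ u ∈ curveBall h x₀ ε, ∀ a ∈ W, DevelopsTo Γ x₀ x₁ u a → a = κ u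
  continuousOn : ContinuousOn κ (curveBall h x₀ ε)
  timelike : ∀ u ∈ curveBall h x₀ ε, g x₀ (κ u) (κ u) < 0
  norm_le : ∀ u ∈ curveBall h x₀ ε, rnorm h x₀ (κ u) ≤ C

/-- All the curves `S(u + κ u)`, `u ∈ U_ε`, lie in `V`. -/
def DevelopmentsIn (Γ : ConnectionField) (h : FormField) (x₀ : E4) (ε : ℝ)
    (κ : C(Icc (0 : ℝ) 1, E4) → E4) (V : Set E4) : Prop :=
  ∀ u ∈ curveBall h x₀ ε, ∀ p : ℝ → E4, IsDevelopment Γ x₀ (shift u (κ u)) p →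
    ∀ t ∈ Icc (0 : ℝ) 1, p t ∈ V

/-! ### Lorentz manifolds, their geodesics, and normal charts -/

section Manifold

variable {M : Type*} [TopologicalSpace M] [ChartedSpace E4 M]

/-- The coordinate expression of a field `g` of bilinear forms on `M` in the chart `φ`: the value at
`y` is `(X, Y) ↦ g(dφ⁻¹ X, dφ⁻¹ Y)`. -/
def formInChart
    (g : ∀ x : M, TangentSpace (𝓡 4) x →L[ℝ] TangentSpace (𝓡 4) x →L[ℝ] ℝ)
    (φ : OpenPartialHomeomorph M E4) : FormField := fun y =>
  let D : E4 →L[ℝ] TangentSpace (𝓡 4) (φ.symm y) := mfderiv (𝓡 4) (𝓡 4) φ.symm y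
  (ContinuousLinearMap.precomp ℝ D).comp ((g (φ.symm y)).comp D)

variable (M) in
/-- A smooth Lorentz metric of signature `(-,+,+,+)` on the `4`-manifold `M`. -/
structure LorentzMetric where
  form : ∀ x : M, TangentSpace (𝓡 4) x →L[ℝ] TangentSpace (𝓡 4) x →L[ℝ] ℝ
  /-- Each tangent space has a basis in which the form is the Minkowski product. -/
  lorentz : ∀ x : M, ∃ b : E4 ≃L[ℝ] TangentSpace (𝓡 4) x,
    ∀ X Y, form x (b X) (b Y) = minkowski X Y
  /-- The components of the form are smooth in all charts of the smooth structure. -/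
  smooth : ∀ φ ∈ IsManifold.maximalAtlas (𝓡 4) ∞ M, ContDiffOn ℝ ∞ (formInChart form φ) φ.target

/-- `c : [0, T] → M` is a geodesic of the Levi-Civita connection of `g`: near each parameter it
satisfies, in some chart of the smooth structure, the geodesic equation. -/
def IsLorentzGeodesic (g : LorentzMetric M) (T : ℝ) (c : ℝ → M) : Prop :=
  ContinuousOn c (Icc 0 T) ∧
    ∀ t₀ ∈ Icc 0 T, ∃ φ ∈ IsManifold.maximalAtlas (𝓡 4) ∞ M, c t₀ ∈ φ.source ∧
      ∃ v : ℝ → E4, ∀ᶠ t in 𝓝[Icc 0 T] t₀,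
        SolvesGeodesicEq (christoffel (formInChart g.form φ)) (Icc 0 T) (fun s => φ (c s)) v t

/-- The velocity `c'(t) ∈ T_{c(t)} M` of a curve `c : [0, T] → M`. -/
def velocity (T : ℝ) (c : ℝ → M) (t : ℝ) : TangentSpace (𝓡 4) (c t) :=
  mfderivWithin 𝓘(ℝ, ℝ) (𝓡 4) c (Icc 0 T) t (1 : ℝ)

/-- The curve `c : [0, T] → M` is time-like. -/
def IsTimelike (g : LorentzMetric M) (T : ℝ) (c : ℝ → M) : Prop :=
  ∀ t ∈ Icc 0 T, g.form (c t) (velocity T c t) (velocity T c t) < 0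

/-- `q = exp_m X` for the Levi-Civita connection of `g`: some geodesic `c : [0, 1] → M` starts at
`m` with velocity `X` and ends at `q`. -/
def IsExp (g : LorentzMetric M) (m : M) (X : TangentSpace (𝓡 4) m) (q : M) : Prop :=
  ∃ c : ℝ → M, IsLorentzGeodesic g 1 c ∧
    (⟨c 0, velocity 1 c 0⟩ : TangentBundle (𝓡 4) M) = ⟨m, X⟩ ∧ c 1 = q

/-- The reference frame at an event: a Lorentz-orthonormal basis of `T_m M`, by which `T_m M` is
identified with `ℝ⁴`, and a neighbourhood `O = chart.target` of its origin which `exp_m` identifies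
diffeomorphically with the neighbourhood `chart.source` of `m`. -/
structure ReferenceFrame (g : LorentzMetric M) where
  event : M
  basis : E4 ≃L[ℝ] TangentSpace (𝓡 4) event
  orthonormal : ∀ X Y, g.form event (basis X) (basis Y) = minkowski X Y
  chart : OpenPartialHomeomorph M E4
  chart_mem : chart ∈ IsManifold.maximalAtlas (𝓡 4) ∞ M
  zero_mem : (0 : E4) ∈ chart.target
  exp : ∀ X ∈ chart.target, IsExp g event (basis X) (chart.symm X)

/-- The Lorentz metric on `O ⊆ T_m M ≅ ℝ⁴`. -/
def ReferenceFrame.metric {g : LorentzMetric M} (F : ReferenceFrame g) : FormField :=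
  formInChart g.form F.chart

end Manifold

end

/-! ### The fixed point theorems of Brouwer and Schauder -/

/-! Let `P` be the parallel translation of `∇` along the curve `p = S v`, so that `p' = P v` and the
`∇`-acceleration of `p` is `P v'`. Since `∇̄ = ∇ - G`, the curve is a Levi-Civita geodesic exactly
when `v' = P⁻¹ G_p(P v, P v)`, the function `pulledBackForce`. Writing `v = u + κ u` with `u 0 = 0`,
the endpoint condition holds by the choice of `κ`, and what is left is a fixed point equation `u t =
∫₀ᵗ P⁻¹ G_p(P v, P v)`.

As `∇` is compatible with `h`, each `P t` is an isometry. With `‖v‖ ≤ ε + C` the integrand has norm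
at most `‖G‖ (ε + C)² ≤ ε`, so the integral operator maps the `ε`-Lipschitz curves starting at `0`
into themselves. These form a compact convex subset of `U_ε`, and Schauder's theorem applies
(`IsAdmissible.exists_geodesic`). The square `g(p', p')` is constant along the resulting geodesic,
and at time `0` it is `g(κ u, κ u) < 0`.

For the existence of admissible data, consider the endpoint `S(u + a)(1)` as a function of `a`. At
`u = 0` and the initial vector of the geodesic its derivative is invertible, because a kernel vector
yields a Jacobi field vanishing at both ends (`NotConjugateAlong.exists_equiv`). A quantitative
inverse function theorem, uniform in small `u`, then gives `κ`
(`IsFrameGeodesic.exists_isAdmissible`).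

Schauder's theorem is reduced to Brouwer's by partitions of unity, and Brouwer's to the absence of a
`C¹` retraction onto the sphere, shown by a volume computation. -/

open Metric MeasureTheory in
/-- There is no `C¹` retraction of the closed unit ball of a Euclidean space onto the sphere. -/
theorem not_exists_contDiffOn_retraction {E : Type*} [NormedAddCommGroup E]
    [InnerProductSpace ℝ E] [FiniteDimensional ℝ E] {r : E → E} {U : Set E}
    (hU : IsOpen U) (hBU : closedBall 0 1 ⊆ U) (hr : ContDiffOn ℝ 1 r U)
    (hr1 : ∀ x ∈ closedBall (0 : E) 1, ‖r x‖ = 1)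
    (hr2 : ∀ x, ‖x‖ = 1 → r x = x) : False := by
  borelize E
  set B : Set E := closedBall 0 1 with hB
  have hBc : IsCompact B := isCompact_closedBall 0 1
  set A : E → E →L[ℝ] E := fun x => fderiv ℝ r x - ContinuousLinearMap.id ℝ E with hA
  have hrd : ∀ x ∈ B, HasFDerivAt r (fderiv ℝ r x) x := fun x hx =>
    ((hr.differentiableOn one_ne_zero).differentiableAt (hU.mem_nhds (hBU hx))).hasFDerivAt
  have hAc : ContinuousOn A B :=
    ((hr.continuousOn_fderiv_of_isOpen hU le_rfl).mono hBU).sub continuousOn_const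
  obtain ⟨L, hL⟩ : ∃ L, LipschitzOnWith L (fun x => r x - x) B :=
    ((hr.mono hBU).sub contDiffOn_id).exists_lipschitzOnWith one_ne_zero
      (convex_closedBall 0 1) hBc
  -- the displacement, extended by zero
  set k : E → E := fun x => if ‖x‖ ≤ 1 then r x - x else 0 with hk
  have hkB : ∀ x ∈ B, k x = r x - x := fun x hx => by
    simp only [hk]; rw [if_pos (by simpa [hB] using hx)]
  have hkout : ∀ x, 1 ≤ ‖x‖ → k x = 0 := fun x hx => by
    simp only [hk]
    split_ifs with h
    · rw [hr2 x (le_antisymm h hx), sub_self]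
    · rfl
  -- The segment from inside to outside meets the sphere, where the displacement vanishes, so the
  -- Lipschitz bound inside the ball suffices.
  have hcross : ∀ x y : E, ‖x‖ ≤ 1 → 1 < ‖y‖ → ‖k x - k y‖ ≤ L * ‖x - y‖ := by
    intro x y hx hy
    obtain ⟨z, hz, hz1⟩ : ∃ z ∈ segment ℝ x y, ‖z‖ = 1 := by
      have := (convex_segment x y).isPreconnected.intermediate_value
        (left_mem_segment ℝ x y) (right_mem_segment ℝ x y) (f := fun z : E => ‖z‖)
        continuous_norm.continuousOn
      obtain ⟨z, hz, h1⟩ := this ⟨hx, hy.le⟩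
      exact ⟨z, hz, h1⟩
    have h1 : ‖x - z‖ ≤ ‖x - y‖ := by
      have := dist_add_dist_of_mem_segment hz
      rw [← dist_eq_norm, ← dist_eq_norm, ← this]
      linarith [dist_nonneg (x := z) (y := y)]
    have hxB : x ∈ B := by simpa [hB] using hx
    have hzB : z ∈ B := by simp [hB, hz1]
    have h2 := hL.dist_le_mul x hxB z hzB
    rw [hkout y hy.le, ← hkout z hz1.ge, hkB x hxB, hkB z hzB]
    rw [dist_eq_norm, dist_eq_norm] at h2
    exact h2.trans (mul_le_mul_of_nonneg_left h1 L.2)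
  have hkL : LipschitzWith L k := by
    refine LipschitzWith.of_dist_le_mul fun x y => ?_
    rw [dist_eq_norm, dist_eq_norm]
    rcases le_or_gt ‖x‖ 1 with hx | hx <;> rcases le_or_gt ‖y‖ 1 with hy | hy
    · have hxB : x ∈ B := by simpa [hB] using hx
      have hyB : y ∈ B := by simpa [hB] using hy
      have h2 := hL.dist_le_mul x hxB y hyB
      rw [hkB x hxB, hkB y hyB]
      simpa [dist_eq_norm] using h2
    · exact hcross x y hx hy
    · rw [norm_sub_rev, norm_sub_rev x]; exact hcross y x hy hx
    · rw [hkout x hx.le, hkout y hy.le]; simp; positivity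
  -- for small `s` the map `x ↦ x + s • k x` permutes the ball
  have hbij : ∀ s : ℝ, 0 ≤ s → s ≤ 1 → s * L < 1 →
      InjOn (fun x => x + s • k x) B ∧ (fun x => x + s • k x) '' B = B := by
    intro s hs0 hs1 hsL
    have happ : ApproximatesLinearOn (fun x => x + s • k x)
        ((ContinuousLinearEquiv.refl ℝ E : E ≃L[ℝ] E) : E →L[ℝ] E) univ (Real.toNNReal s * L) := by
      intro x _ y _
      have h2 := hkL.dist_le_mul x y
      rw [dist_eq_norm, dist_eq_norm] at h2
      have : (x + s • k x - (y + s • k y) - (x - y)) = s • (k x - k y) := by module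
      simp only [ContinuousLinearEquiv.coe_refl, ContinuousLinearMap.coe_id', id_eq]
      rw [this, norm_smul, Real.norm_of_nonneg hs0]
      push_cast
      calc s * ‖k x - k y‖ ≤ s * (L * ‖x - y‖) := mul_le_mul_of_nonneg_left h2 hs0
        _ = _ := by rw [Real.coe_toNNReal s hs0]; ring
    have hc : Subsingleton E ∨ (Real.toNNReal s * L : NNReal) <
        ‖((ContinuousLinearEquiv.refl ℝ E).symm : E →L[ℝ] E)‖₊⁻¹ := by
      rcases subsingleton_or_nontrivial E with h | h
      · exact Or.inl h
      · right
        have : ‖((ContinuousLinearEquiv.refl ℝ E).symm : E →L[ℝ] E)‖₊ = 1 := by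
          simp
        rw [this, inv_one, ← NNReal.coe_lt_coe]
        push_cast
        rwa [Real.coe_toNNReal s hs0]
    have hinj : Function.Injective (fun x => x + s • k x) := by
      rw [← injOn_univ]; exact happ.injOn hc
    have hsurj : Function.Surjective (fun x => x + s • k x) := happ.surjective hc
    refine ⟨hinj.injOn, Subset.antisymm ?_ ?_⟩
    · rintro _ ⟨x, hx, rfl⟩
      have hx1 : ‖x‖ ≤ 1 := by simpa [hB] using hx
      simp only [hB, mem_closedBall_zero_iff]
      rw [hkB x hx]
      calc ‖x + s • (r x - x)‖ = ‖(1 - s) • x + s • r x‖ := by congr 1; module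
        _ ≤ (1 - s) * ‖x‖ + s * ‖r x‖ := by
          refine (norm_add_le _ _).trans ?_
          rw [norm_smul, norm_smul, Real.norm_of_nonneg hs0,
            Real.norm_of_nonneg (by linarith : (0:ℝ) ≤ 1 - s)]
        _ ≤ 1 := by rw [hr1 x hx]; nlinarith
    -- The map is the identity outside the ball, so a preimage of a point of the ball cannot lie
    -- outside.
    · intro y hy
      obtain ⟨x, hx⟩ := hsurj y
      refine ⟨x, ?_, hx⟩
      by_contra hxB
      have hx1 : 1 < ‖x‖ := by simpa [hB] using hxB
      have : x = y := by
        have h3 := hx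
        simp only [hkout x hx1.le, smul_zero, add_zero] at h3
        exact h3
      exact hxB (this ▸ hy)
  -- the volume of the image is an integral of a determinant
  have hderiv : ∀ s : ℝ, ∀ x ∈ B, HasFDerivWithinAt (fun x => x + s • k x)
      (ContinuousLinearMap.id ℝ E + s • A x) B x := by
    intro s x hx
    have h1 : HasFDerivAt (fun x => x + s • (r x - x))
        (ContinuousLinearMap.id ℝ E + s • A x) x :=
      (hasFDerivAt_id x).add (((hrd x hx).sub (hasFDerivAt_id x)).const_smul s)
    refine h1.hasFDerivWithinAt.congr (fun y hy => ?_) ?_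
    · rw [hkB y hy]
    · rw [hkB x hx]
  obtain ⟨N, hN⟩ : ∃ N, ∀ x ∈ B, ‖A x‖ ≤ N := hBc.exists_bound_of_continuousOn hAc
  -- Near the identity the determinant is positive, which removes the absolute value from the change
  -- of variables formula.
  obtain ⟨η, hη0, hη⟩ : ∃ η > 0, ∀ D : E →L[ℝ] E, ‖D‖ < η →
      0 < (ContinuousLinearMap.id ℝ E + D).det := by
    have hc : Continuous fun D : E →L[ℝ] E => (ContinuousLinearMap.id ℝ E + D).det :=
      ContinuousLinearMap.continuous_det.comp (continuous_const.add continuous_id)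
    have h1 : (0:ℝ) < (ContinuousLinearMap.id ℝ E + (0 : E →L[ℝ] E)).det := by
      rw [add_zero]
      simp [ContinuousLinearMap.det]
    obtain ⟨η, hη0, hη⟩ := Metric.mem_nhds_iff.1 (hc.continuousAt.eventually (lt_mem_nhds h1))
    exact ⟨η, hη0, fun D hD => hη (by simpa using hD)⟩
  obtain ⟨s₁, hs₁0, hs₁⟩ : ∃ s₁ > (0 : ℝ), ∀ s, 0 ≤ s → s ≤ s₁ →
      s ≤ 1 ∧ s * L < 1 ∧ ∀ x ∈ B, 0 < (ContinuousLinearMap.id ℝ E + s • A x).det := by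
    have hL0 : (0 : ℝ) ≤ L := L.2
    refine ⟨min 1 (min (1 / ((L : ℝ) + 1)) (η / (|N| + 1))) / 2, by positivity, fun s hs0 hs => ?_⟩
    have h1 : s < 1 ∧ s < 1 / (L + 1) ∧ s < η / (|N| + 1) := by
      have h0 : 0 < min 1 (min (1 / ((L : ℝ) + 1)) (η / (|N| + 1))) := by positivity
      have h2 : s < min 1 (min (1 / ((L : ℝ) + 1)) (η / (|N| + 1))) := by linarith
      simpa [lt_min_iff] using h2
    refine ⟨h1.1.le, ?_, fun x hx => hη _ ?_⟩
    · have := h1.2.1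
      rw [lt_div_iff₀ (by positivity)] at this
      nlinarith
    · have := h1.2.2
      rw [lt_div_iff₀ (by positivity)] at this
      rw [norm_smul, Real.norm_of_nonneg hs0]
      have h3 := (hN x hx).trans (le_abs_self N)
      nlinarith [mul_le_mul_of_nonneg_left h3 hs0]
  have hvol : ∀ s, 0 ≤ s → s ≤ s₁ →
      ∫ x in B, (ContinuousLinearMap.id ℝ E + s • A x).det = (volume B).toReal := by
    intro s hs0 hs
    obtain ⟨h1, h2, h3⟩ := hs₁ s hs0 hs
    obtain ⟨hi, him⟩ := hbij s hs0 h1 h2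
    have h4 := integral_image_eq_integral_abs_det_fderiv_smul volume hBc.measurableSet
      (hderiv s) hi (fun _ => (1:ℝ))
    rw [him] at h4
    simp only [integral_const, smul_eq_mul, mul_one] at h4
    have h5 : ∫ x in B, |(ContinuousLinearMap.id ℝ E + s • A x).det| =
        ∫ x in B, (ContinuousLinearMap.id ℝ E + s • A x).det :=
      setIntegral_congr_fun hBc.measurableSet fun x hx => abs_of_pos (h3 x hx)
    rw [← h5, ← h4]
    simp [Measure.real]
  -- the determinant is a polynomial in `s`
  set n := Module.finrank ℝ E with hn
  have hpoly : ∀ D : E →L[ℝ] E, ∃ p : Polynomial ℝ, p.natDegree ≤ n ∧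
      ∀ s : ℝ, p.eval s = (ContinuousLinearMap.id ℝ E + s • D).det := by
    intro D
    set b := Module.finBasis ℝ E
    set m := LinearMap.toMatrix b b (D : E →ₗ[ℝ] E) with hm
    refine ⟨Matrix.det ((Polynomial.X : Polynomial ℝ) • m.map Polynomial.C +
      (1 : Matrix (Fin n) (Fin n) ℝ).map Polynomial.C), (Polynomial.natDegree_det_X_add_C_le _ _).trans (by simp [hn]), fun s => ?_⟩
    rw [← Polynomial.coe_evalRingHom, RingHom.map_det, ContinuousLinearMap.det,
      ← LinearMap.det_toMatrix b]
    have h1 : LinearMap.toMatrix b b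
        ((ContinuousLinearMap.id ℝ E + s • D : E →L[ℝ] E) : E →ₗ[ℝ] E) = s • m + 1 := by
      rw [hm, add_comm, ContinuousLinearMap.toLinearMap_add, ContinuousLinearMap.toLinearMap_smul,
        map_add, map_smul, show ((ContinuousLinearMap.id ℝ E : E →L[ℝ] E) : E →ₗ[ℝ] E) = LinearMap.id from rfl,
        LinearMap.toMatrix_id]
    rw [h1]
    congr 1
    ext i j
    rcases eq_or_ne i j with rfl | hij
    · simp only [RingHom.mapMatrix_apply, Matrix.map_apply, Matrix.add_apply, Matrix.smul_apply,
        Polynomial.coe_evalRingHom, smul_eq_mul, Matrix.one_apply_eq, Polynomial.eval_add,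
        Polynomial.eval_mul, Polynomial.eval_X, Polynomial.eval_C]
    · simp only [RingHom.mapMatrix_apply, Matrix.map_apply, Matrix.add_apply, Matrix.smul_apply,
        Polynomial.coe_evalRingHom, smul_eq_mul, Matrix.one_apply_ne hij, Polynomial.eval_add,
        Polynomial.eval_mul, Polynomial.eval_X, Polynomial.eval_C]
  -- These are `n + 1` distinct nodes in `[0, s₁]`. Lagrange interpolation writes the value at `1`
  -- of a polynomial of degree at most `n` as a fixed combination of its values there, so the volume
  -- identity for small `s` extends to `s = 1`.
  set v : ℕ → ℝ := fun i => s₁ * (i / (n + 1)) with hv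
  have hv0 : ∀ i, 0 ≤ v i := fun i => by positivity
  have hv1 : ∀ i ∈ Finset.range (n + 1), v i ≤ s₁ := fun i hi => by
    have hi' : (i : ℝ) ≤ n + 1 := by
      have := Finset.mem_range.1 hi
      exact_mod_cast this.le
    have : (i : ℝ) / (n + 1) ≤ 1 := div_le_one_of_le₀ hi' (by positivity)
    simpa [hv] using mul_le_mul_of_nonneg_left this hs₁0.le
  have hvinj : Set.InjOn v (Finset.range (n + 1)) := by
    intro i _ j _ hij
    have hn0 : (n : ℝ) + 1 ≠ 0 := by positivity
    simp only [hv] at hij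
    field_simp at hij
    exact_mod_cast hij
  set ℓ : ℕ → ℝ := fun i => (Lagrange.basis (Finset.range (n + 1)) v i).eval 1 with hℓ
  have hint : ∀ p : Polynomial ℝ, p.natDegree ≤ n →
      p.eval 1 = ∑ i ∈ Finset.range (n + 1), p.eval (v i) * ℓ i := by
    intro p hp
    have hdeg : p.degree < (Finset.range (n + 1)).card := by
      rw [Finset.card_range]
      exact (Polynomial.degree_le_of_natDegree_le hp).trans_lt (by exact_mod_cast Nat.lt_succ_self n)
    have h1 := Lagrange.eq_interpolate hvinj hdeg
    conv_lhs => rw [h1]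
    simp [Lagrange.interpolate_apply, Polynomial.eval_finsetSum, hℓ]
  -- The function `‖r‖²` is constant on the open ball. If `Dr` were onto, a vector `w` with `Dr w =
  -- r x` would give `2 ‖r x‖² = 0`.
  have hdet0 : ∀ x ∈ ball (0 : E) 1, (ContinuousLinearMap.id ℝ E + (1 : ℝ) • A x).det = 0 := by
    intro x hx
    have hxB := ball_subset_closedBall hx
    have h1 : ContinuousLinearMap.id ℝ E + (1 : ℝ) • A x = fderiv ℝ r x := by simp [hA]
    rw [h1]
    by_contra hne
    have hsurj : Function.Surjective (fderiv ℝ r x) :=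
      (LinearMap.equivOfDetNeZero _ hne).surjective
    obtain ⟨w, hw⟩ := hsurj (r x)
    have h2 : HasFDerivAt (fun y => ‖r y‖ ^ 2) _ x := (hrd x hxB).norm_sq
    have h3 : HasFDerivAt (fun y => ‖r y‖ ^ 2) (0 : E →L[ℝ] ℝ) x := by
      refine (hasFDerivAt_const (1 : ℝ) x).congr_of_eventuallyEq ?_
      filter_upwards [isOpen_ball.mem_nhds hx] with y hy
      rw [hr1 y (ball_subset_closedBall hy), one_pow]
    have h4 := congrArg (fun D : E →L[ℝ] ℝ => D w) (h2.unique h3)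
    simp only [zero_apply] at h4
    have h5 : (2:ℝ) * inner ℝ (r x) (r x) = 0 := by simpa [hw] using h4
    rw [real_inner_self_eq_norm_sq, hr1 x hxB] at h5
    norm_num at h5
  -- conclusion
  have hdetc : ∀ s : ℝ, IntegrableOn
      (fun x => (ContinuousLinearMap.id ℝ E + s • A x).det) B volume := fun s =>
    (ContinuousLinearMap.continuous_det.comp_continuousOn
      (continuousOn_const.add (hAc.const_smul s))).integrableOn_compact hBc
  have hkey : ∀ x, (ContinuousLinearMap.id ℝ E + (1 : ℝ) • A x).det =
      ∑ i ∈ Finset.range (n + 1), (ContinuousLinearMap.id ℝ E + v i • A x).det * ℓ i := by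
    intro x
    obtain ⟨p, hp, hpe⟩ := hpoly (A x)
    have := hint p hp
    simpa only [hpe] using this
  have hI1 : ∫ x in B, (ContinuousLinearMap.id ℝ E + (1 : ℝ) • A x).det = (volume B).toReal := by
    simp_rw [hkey]
    rw [integral_finsetSum _ fun i _ => (hdetc (v i)).mul_const (ℓ i)]
    -- The weights sum to `1` because interpolation reproduces the constant polynomial.
    have h1 : ∑ i ∈ Finset.range (n + 1), ℓ i = 1 := by
      have := hint (Polynomial.C 1) (by simp)
      simpa using this.symm
    rw [← mul_one (volume B).toReal, ← h1, Finset.mul_sum]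
    refine Finset.sum_congr rfl fun i hi => ?_
    rw [integral_mul_const, hvol (v i) (hv0 i) (hv1 i hi)]
  have hI0 : ∫ x in B, (ContinuousLinearMap.id ℝ E + (1 : ℝ) • A x).det = 0 := by
    refine integral_eq_zero_of_ae ?_
    filter_upwards [ae_restrict_mem hBc.measurableSet, ae_restrict_of_ae
      (measure_eq_zero_iff_ae_notMem.1 (Measure.addHaar_sphere_of_ne_zero volume (0 : E)
        (one_ne_zero (α := ℝ))))] with x hx hxs
    exact hdet0 x (mem_ball.2 (lt_of_le_of_ne hx hxs))
  have hpos : 0 < (volume B).toReal :=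
    ENNReal.toReal_pos (measure_closedBall_pos volume 0 one_pos).ne' hBc.measure_lt_top.ne
  linarith

open Metric in
/-- **Brouwer's fixed point theorem** for the unit ball of a Euclidean space. -/
theorem exists_fixedPoint_of_continuous_of_norm_le_one {E : Type*} [NormedAddCommGroup E]
    [InnerProductSpace ℝ E] [FiniteDimensional ℝ E] {f : E → E} (hf : Continuous f)
    (hf1 : ∀ x, ‖f x‖ ≤ 1) : ∃ x, f x = x := by
  by_contra! hne
  have hBc : IsCompact (closedBall (0 : E) 1) := isCompact_closedBall 0 1
  obtain ⟨x₀, -, hx₀⟩ := hBc.exists_isMinOn ⟨0, by simp⟩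
    (f := fun x => ‖f x - x‖) (by fun_prop)
  set δ := ‖f x₀ - x₀‖ with hδ
  have hδ0 : 0 < δ := norm_pos_iff.2 (sub_ne_zero.2 (hne x₀))
  -- A smooth map closer to `f` than the minimal displacement `δ` still has no fixed point in the
  -- ball, and its values stay in the ball.
  obtain ⟨g, hg⟩ := exists_contMDiffMap_forall_mem_convex_of_local_const (n := ⊤)
    (modelWithCornersSelf ℝ E) (t := fun x => ball (f x) δ ∩ closedBall 0 1)
    (fun x => (convex_ball _ _).inter (convex_closedBall _ _)) (fun x => ⟨f x, by
      filter_upwards [hf.continuousAt.eventually (ball_mem_nhds (f x) hδ0)] with y hy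
      exact ⟨by rw [mem_ball_comm]; exact hy, by simpa using hf1 x⟩⟩)
  have hgs : ContDiff ℝ 1 g := g.contMDiff.contDiff.of_le (by exact_mod_cast le_top)
  set w : E → E := fun x => x - g x with hw
  have hwB : ∀ x ∈ closedBall (0 : E) 1, w x ≠ 0 := by
    intro x hx h0
    have h1 : x = g x := sub_eq_zero.1 h0
    have h2 := (hg x).1
    rw [← h1, mem_ball, dist_comm, dist_eq_norm] at h2
    exact absurd (hx₀ hx) (not_le.2 h2)
  have hg1 : ∀ x, ‖g x‖ ≤ 1 := fun x => by simpa using (hg x).2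
  have hws : ContDiff ℝ 1 w := contDiff_id.sub hgs
  -- The retraction follows the ray from `g x` through `x` to the sphere. The equation `‖x + l • w
  -- x‖² = 1` is quadratic in `l`, with half linear coefficient `b` and quarter discriminant `D`;
  -- `r` uses the larger root.
  set b : E → ℝ := fun x => inner ℝ x (w x) with hb
  set D : E → ℝ := fun x => b x ^ 2 + ‖w x‖ ^ 2 * (1 - ‖x‖ ^ 2) with hD
  have hbs : ContDiff ℝ 1 b := contDiff_id.inner ℝ hws
  have hqs : ContDiff ℝ 1 fun x => ‖w x‖ ^ 2 := hws.norm_sq ℝ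
  have hDs : ContDiff ℝ 1 D := (hbs.pow 2).add
    (hqs.mul (contDiff_const.sub (contDiff_id.norm_sq ℝ)))
  -- On the sphere `0 < ‖w‖² = 1 - 2⟨x, g x⟩ + ‖g x‖² ≤ 2 b`. Hence the larger root there is `0` and
  -- `r` fixes the sphere.
  have hb1 : ∀ x, ‖x‖ = 1 → 0 < b x := by
    intro x hx
    have h0 : 0 < ‖w x‖ ^ 2 := by
      have := norm_pos_iff.2 (hwB x (by simp [hx])); positivity
    have h1 : ‖w x‖ ^ 2 = 1 - 2 * inner ℝ x (g x) + ‖g x‖ ^ 2 := by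
      simp only [hw]; rw [norm_sub_sq_real, hx]; ring
    have h2 : b x = 1 - inner ℝ x (g x) := by
      simp only [hb, hw]; rw [inner_sub_right, real_inner_self_eq_norm_sq, hx]; ring
    have h3 := hg1 x
    nlinarith [norm_nonneg (g x)]
  have hDB : ∀ x ∈ closedBall (0 : E) 1, 0 < D x := by
    intro x hx
    rcases (mem_closedBall_zero_iff.1 hx).lt_or_eq with h | h
    · have h1 := norm_pos_iff.2 (hwB x hx)
      have h2 : 0 < 1 - ‖x‖ ^ 2 := by nlinarith [norm_nonneg x]
      simp only [hD]; positivity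
    · have := hb1 x h
      simp only [hD, h]; simpa using by positivity
  set r : E → E := fun x => x + ((-b x + Real.sqrt (D x)) / ‖w x‖ ^ 2) • w x with hr
  have hUo : IsOpen {x | w x ≠ 0 ∧ 0 < D x} :=
    (isOpen_ne_fun hws.continuous continuous_const).inter
      (isOpen_lt continuous_const hDs.continuous)
  refine not_exists_contDiffOn_retraction (r := r) hUo (fun x hx => ⟨hwB x hx, hDB x hx⟩)
    (contDiffOn_id.add (((hbs.neg.contDiffOn.add (hDs.contDiffOn.sqrt fun x hx => hx.2.ne')).div
      hqs.contDiffOn fun x hx => by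
        have := norm_pos_iff.2 hx.1
        positivity).smul hws.contDiffOn)) ?_ ?_
  · intro x hx
    have h1 := norm_pos_iff.2 (hwB x hx)
    have h2 := Real.sq_sqrt (hDB x hx).le
    have h3 : ‖r x‖ ^ 2 = 1 := by
      simp only [hr]
      rw [norm_add_sq_real, inner_smul_right, norm_smul, mul_pow, Real.norm_eq_abs, sq_abs]
      change ‖x‖ ^ 2 + 2 * ((-b x + √(D x)) / ‖w x‖ ^ 2 * b x) +
        ((-b x + √(D x)) / ‖w x‖ ^ 2) ^ 2 * ‖w x‖ ^ 2 = 1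
      field_simp
      have h4 : D x = b x ^ 2 + ‖w x‖ ^ 2 * (1 - ‖x‖ ^ 2) := rfl
      nlinarith
    exact (pow_eq_one_iff_of_nonneg (norm_nonneg _) two_ne_zero).1 h3
  · intro x hx
    have h1 : D x = b x ^ 2 := by simp [hD, hx]
    simp only [hr, h1, Real.sqrt_sq (hb1 x hx).le]
    simp

open Metric in
/-- The approximate form of Schauder's fixed point theorem. -/
theorem IsCompact.exists_norm_sub_le_of_mapsTo {F : Type*} [NormedAddCommGroup F]
    [NormedSpace ℝ F] {K : Set F} (hK : IsCompact K) (hKc : Convex ℝ K) (hK0 : K.Nonempty)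
    {f : F → F} (hf : ContinuousOn f K) (hfK : MapsTo f K K) {ε : ℝ} (hε : 0 < ε) :
    ∃ x ∈ K, ‖f x - x‖ ≤ ε := by
  classical
  obtain ⟨t, htK, htf, hcov⟩ := hK.finite_cover_balls hε
  have : Fintype t := htf.fintype
  have hne : Nonempty t := by
    obtain ⟨x, hx⟩ := hK0
    obtain ⟨y, hy, -⟩ := mem_iUnion₂.1 (hcov hx)
    exact ⟨⟨y, hy⟩⟩
  set N : ℝ := ((Fintype.card t : ℕ) : ℝ) with hN
  have hN0 : 0 < N := Nat.cast_pos.2 Fintype.card_pos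
  set S : EuclideanSpace ℝ t → ℝ := fun l => ∑ i, max (l i) 0 with hS
  -- This retracts the whole coordinate space onto the standard simplex, so that Brouwer's theorem
  -- can be used for a map defined everywhere.
  set ρ : EuclideanSpace ℝ t → t → ℝ := fun l i =>
    (max (l i) 0 + max (1 - S l) 0 / N) / max 1 (S l) with hρ
  have hρ0 : ∀ l i, 0 ≤ ρ l i := fun l i => by simp only [hρ]; positivity
  have hmax : ∀ l, 0 < max 1 (S l) := fun l => lt_max_of_lt_left one_pos
  have hρ1 : ∀ l, ∑ i, ρ l i = 1 := by
    intro l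
    simp only [hρ]
    rw [← Finset.sum_div, Finset.sum_add_distrib, Finset.sum_const, Finset.card_univ, nsmul_eq_mul,
      ← hN, mul_div_cancel₀ _ hN0.ne', div_eq_one_iff_eq (hmax l).ne']
    change S l + _ = _
    rcases le_total 1 (S l) with h | h
    · rw [max_eq_right h, max_eq_right (by linarith)]; ring
    · rw [max_eq_left h, max_eq_left (by linarith)]; ring
  have hSc : Continuous S := by fun_prop
  have hρc : ∀ i, Continuous fun l => ρ l i := fun i =>
    Continuous.div (by fun_prop) (by fun_prop) fun l => (hmax l).ne'
  set σ : EuclideanSpace ℝ t → F := fun l => ∑ i, ρ l i • (i : F) with hσ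
  have hσK : ∀ l, σ l ∈ K := fun l =>
    hKc.sum_mem (fun i _ => hρ0 l i) (hρ1 l) fun i _ => htK i.2
  have hσc : Continuous σ := continuous_finsetSum _ fun i _ => (hρc i).smul continuous_const
  have hfσ : Continuous fun l => f (σ l) := hf.comp_continuous hσc hσK
  -- Unnormalized partition of unity for the `ε`-balls about the net: the `i`-th function vanishes
  -- at distance at least `ε` from the point `i`.
  set φ : F → t → ℝ := fun y i => max (ε - ‖y - i‖) 0 with hφ
  have hφ0 : ∀ y i, 0 ≤ φ y i := fun y i => le_max_right _ _
  have hφpos : ∀ y ∈ K, 0 < ∑ i, φ y i := by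
    intro y hy
    obtain ⟨x, hx, hyx⟩ := mem_iUnion₂.1 (hcov hy)
    refine Finset.sum_pos' (fun i _ => hφ0 y i) ⟨⟨x, hx⟩, Finset.mem_univ _, ?_⟩
    rw [mem_ball, dist_eq_norm] at hyx
    exact lt_max_of_lt_left (by simpa using hyx)
  set ψ : F → t → ℝ := fun y i => φ y i / ∑ j, φ y j with hψ
  have hψ0 : ∀ y ∈ K, ∀ i, 0 ≤ ψ y i := fun y hy i => div_nonneg (hφ0 y i) (hφpos y hy).le
  have hψ1 : ∀ y ∈ K, ∑ i, ψ y i = 1 := fun y hy => by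
    simp only [hψ]; rw [← Finset.sum_div, div_self (hφpos y hy).ne']
  set Ψ : EuclideanSpace ℝ t → EuclideanSpace ℝ t := fun l => WithLp.toLp 2 (ψ (f (σ l))) with hΨ
  have hφc : ∀ i, Continuous fun l => φ (f (σ l)) i := fun i =>
    (continuous_const.sub (hfσ.sub continuous_const).norm).max continuous_const
  have hΨc : Continuous Ψ := by
    refine (PiLp.continuous_toLp 2 _).comp (continuous_pi fun i => ?_)
    exact (hφc i).div (continuous_finsetSum _ fun j _ => hφc j) fun l =>
      (hφpos _ (hfK (hσK l))).ne'
  obtain ⟨l, hl⟩ := exists_fixedPoint_of_continuous_of_norm_le_one hΨc fun l => by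
    have hy := hfK (hσK l)
    rw [EuclideanSpace.norm_eq, Real.sqrt_le_one, ← hψ1 _ hy]
    refine Finset.sum_le_sum fun i _ => ?_
    have h1 : ψ (f (σ l)) i ≤ 1 := by
      rw [← hψ1 _ hy]
      exact Finset.single_le_sum (fun j _ => hψ0 _ hy j) (Finset.mem_univ i)
    have h2 := hψ0 _ hy i
    change ‖ψ (f (σ l)) i‖ ^ 2 ≤ _
    rw [Real.norm_of_nonneg h2]
    nlinarith
  have hy := hfK (hσK l)
  have hli : ∀ i, l i = ψ (f (σ l)) i := fun i => by
    conv_lhs => rw [← hl]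
  have hl0 : ∀ i, 0 ≤ l i := fun i => by rw [hli]; exact hψ0 _ hy i
  have hSl : S l = 1 := by
    rw [← hψ1 _ hy]
    exact Finset.sum_congr rfl fun i _ => by rw [max_eq_left (hl0 i), hli]
  have hρl : ∀ i, ρ l i = l i := fun i => by
    simp [hρ, hSl, max_eq_left (hl0 i)]
  refine ⟨σ l, hσK l, ?_⟩
  have h1 : f (σ l) - σ l = ∑ i, ρ l i • (f (σ l) - i) := by
    simp_rw [smul_sub]
    rw [Finset.sum_sub_distrib, ← Finset.sum_smul, hρ1, one_smul]
  rw [h1]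
  refine (norm_sum_le _ _).trans ?_
  calc ∑ i, ‖ρ l i • (f (σ l) - i)‖ ≤ ∑ i, ρ l i * ε := by
        refine Finset.sum_le_sum fun i _ => ?_
        rw [norm_smul, Real.norm_of_nonneg (hρ0 l i)]
        rcases lt_or_ge ‖f (σ l) - i‖ ε with h | h
        · exact mul_le_mul_of_nonneg_left h.le (hρ0 l i)
        · have : ρ l i = 0 := by
            rw [hρl, hli]
            simp only [hψ, hφ]
            rw [max_eq_right (by linarith), zero_div]
          simp [this]
    _ = ε := by rw [← Finset.sum_mul, hρ1, one_mul]

/-- **Schauder's fixed point theorem** for compact convex sets in a normed space. -/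
theorem IsCompact.exists_fixedPoint_of_mapsTo {F : Type*} [NormedAddCommGroup F]
    [NormedSpace ℝ F] {K : Set F} (hK : IsCompact K) (hKc : Convex ℝ K) (hK0 : K.Nonempty)
    {f : F → F} (hf : ContinuousOn f K) (hfK : MapsTo f K K) : ∃ x ∈ K, f x = x := by
  -- The minimal displacement on `K` is at most every positive `ε`, hence zero.
  obtain ⟨x, hx, hmin⟩ := hK.exists_isMinOn hK0 (hf.sub continuousOn_id).norm
  refine ⟨x, hx, sub_eq_zero.1 (norm_le_zero_iff.1 (le_of_forall_pos_le_add fun ε hε => ?_))⟩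
  obtain ⟨y, hy, hye⟩ := hK.exists_norm_sub_le_of_mapsTo hKc hK0 hf hfK hε
  rw [zero_add]
  exact (hmin hy).trans hye

/-! ### Ordinary differential equations with a control -/

/-- `y` solves `y' = F(y, w)` on `[0, 1]`. -/
def IsControlledCurve {X V : Type*} [NormedAddCommGroup X] [NormedSpace ℝ X]
    (F : X × V → X) (w : ℝ → V) (y : ℝ → X) : Prop :=
  ∀ t ∈ Icc (0 : ℝ) 1, HasDerivWithinAt y (F (y t, w t)) (Icc 0 1) t

/-- A bound uniform in `t` that also covers `K = 0`; it comes from `e^K - 1 ≤ K e^K`, that is, `1 -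
K ≤ e^(-K)`. -/
theorem gronwallBound_zero_le_mul_exp {K ε t : ℝ} (hK : 0 ≤ K) (hε : 0 ≤ ε)
    (ht : t ∈ Icc (0 : ℝ) 1) : gronwallBound 0 K ε t ≤ ε * Real.exp K := by
  rcases hK.eq_or_lt with rfl | hK
  · rw [gronwallBound_K0]
    simpa using mul_le_of_le_one_right hε ht.2
  · rw [gronwallBound_of_K_ne_0 hK.ne']
    have h1 : Real.exp (K * t) ≤ Real.exp K :=
      Real.exp_le_exp.2 (mul_le_of_le_one_right hK.le ht.2)
    have h2 : Real.exp K - 1 ≤ K * Real.exp K := by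
      have := Real.add_one_le_exp (-K)
      have h3 : Real.exp (-K) * Real.exp K = 1 := by rw [← Real.exp_add]; simp
      nlinarith [Real.exp_pos K]
    simp only [zero_mul, zero_add]
    rw [div_mul_eq_mul_div, div_le_iff₀ hK]
    nlinarith [mul_le_mul_of_nonneg_left (h1.trans (by linarith : Real.exp K ≤ 1 + K * Real.exp K)) hε]

/-- Grönwall's inequality with zero initial value, the source of the uniqueness, Lipschitz and
linearization estimates below. -/
theorem norm_le_of_norm_deriv_le_unitInterval {X : Type*} [NormedAddCommGroup X]
    [NormedSpace ℝ X] {e e' : ℝ → X} {K ε : ℝ} (hK : 0 ≤ K) (hε : 0 ≤ ε) (h0 : e 0 = 0)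
    (he : ∀ t ∈ Icc (0 : ℝ) 1, HasDerivWithinAt e (e' t) (Icc 0 1) t)
    (hb : ∀ t ∈ Icc (0 : ℝ) 1, ‖e' t‖ ≤ K * ‖e t‖ + ε) :
    ∀ t ∈ Icc (0 : ℝ) 1, ‖e t‖ ≤ ε * Real.exp K := by
  intro t ht
  have h1 := norm_le_gronwallBound_of_norm_deriv_right_le (f := e) (f' := e') (δ := 0) (K := K)
    (ε := ε) (a := 0) (b := 1) (fun s hs => (he s hs).continuousWithinAt)
    (fun s hs => (he s ⟨hs.1, hs.2.le⟩).mono_of_mem_nhdsWithin (Icc_mem_nhdsGE_of_mem hs))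
    (by simp [h0]) (fun s hs => hb s ⟨hs.1, hs.2.le⟩) t ht
  rw [sub_zero] at h1
  exact h1.trans (gronwallBound_zero_le_mul_exp hK hε ht)

section

set_option linter.unusedSectionVars false

variable {X V : Type*} [NormedAddCommGroup X] [NormedSpace ℝ X] [NormedAddCommGroup V]
  [NormedSpace ℝ V]

theorem IsControlledCurve.continuousOn {F : X × V → X} {w : ℝ → V} {y : ℝ → X}
    (hy : IsControlledCurve F w y) : ContinuousOn y (Icc 0 1) :=
  fun t ht => (hy t ht).continuousWithinAt

/-- A bounded globally Lipschitz controlled equation is solvable on `[0, 1]`. -/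
theorem exists_isControlledCurve_of_lipschitzWith [CompleteSpace X] {F : X × V → X} {K : NNReal}
    (hF : LipschitzWith K F) {L : ℝ} (hL : ∀ z, ‖F z‖ ≤ L) {w : ℝ → V}
    (hw : ContinuousOn w (Icc 0 1)) (x : X) :
    ∃ y : ℝ → X, y 0 = x ∧ IsControlledCurve F w y := by
  have hL0 : 0 ≤ L := (norm_nonneg _).trans (hL (0, w 0))
  -- A field bounded by `L` cannot leave the ball of radius `L` in unit time, so the local theorem
  -- reaches time `1`.
  have hpl : IsPicardLindelof (fun t x => F (x, w t)) (tmin := 0) (tmax := 1)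
      ⟨0, left_mem_Icc.2 zero_le_one⟩ x L.toNNReal 0 L.toNNReal K := by
    refine ⟨fun t _ => ?_, fun x _ => ?_, fun t _ x _ => ?_, ?_⟩
    · refine (LipschitzWith.of_dist_le_mul fun a b => ?_).lipschitzOnWith
      refine (hF.dist_le_mul _ _).trans_eq ?_
      simp [Prod.dist_eq]
    · exact hF.continuous.comp_continuousOn (continuousOn_const.prodMk hw)
    · rw [Real.coe_toNNReal L hL0]; exact hL _
    · simp
  exact hpl.exists_eq_forall_mem_Icc_hasDerivWithinAt₀

/-- Solutions of a globally Lipschitz controlled equation depend on the control in a Lipschitz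
way. -/
theorem norm_sub_le_of_isControlledCurve {F : X × V → X} {K : NNReal} (hF : LipschitzWith K F)
    {w₁ w₂ : ℝ → V} {y₁ y₂ : ℝ → X} (h₁ : IsControlledCurve F w₁ y₁)
    (h₂ : IsControlledCurve F w₂ y₂) (h0 : y₁ 0 = y₂ 0) {D : ℝ}
    (hD : ∀ t ∈ Icc (0 : ℝ) 1, ‖w₁ t - w₂ t‖ ≤ D) :
    ∀ t ∈ Icc (0 : ℝ) 1, ‖y₁ t - y₂ t‖ ≤ K * Real.exp K * D := by
  have hD0 : 0 ≤ D := (norm_nonneg _).trans (hD 0 (left_mem_Icc.2 zero_le_one))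
  intro t ht
  have := norm_le_of_norm_deriv_le_unitInterval (e := fun t => y₁ t - y₂ t) K.2
    (mul_nonneg K.2 hD0) (by simp [h0]) (fun s hs => (h₁ s hs).sub (h₂ s hs)) (fun s hs => ?_) t ht
  · refine this.trans_eq ?_
    change (K : ℝ) * D * Real.exp K = _
    ring
  · have h3 := hF.dist_le_mul (y₁ s, w₁ s) (y₂ s, w₂ s)
    rw [dist_eq_norm, dist_eq_norm] at h3
    refine h3.trans ?_
    change (K : ℝ) * _ ≤ K * _ + K * D
    rw [← mul_add]
    refine mul_le_mul_of_nonneg_left ?_ K.2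
    rw [Prod.norm_def]
    exact max_le (le_add_of_nonneg_right hD0) ((hD s hs).trans (le_add_of_nonneg_left (norm_nonneg _)))

variable [FiniteDimensional ℝ X] [FiniteDimensional ℝ V]

/-- A smooth map agrees on a given ball with a Lipschitz, bounded one. -/
theorem ContDiff.exists_lipschitzWith_eqOn_closedBall {Z Y : Type*} [NormedAddCommGroup Z]
    [NormedSpace ℝ Z] [FiniteDimensional ℝ Z] [NormedAddCommGroup Y] [NormedSpace ℝ Y]
    {F : Z → Y} (hF : ContDiff ℝ 1 F) (R : ℝ) :
    ∃ (G : Z → Y) (K : NNReal) (L : ℝ), LipschitzWith K G ∧ (∀ z, ‖G z‖ ≤ L) ∧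
      ∀ z, ‖z‖ ≤ R → G z = F z := by
  let χ : ContDiffBump (0 : Z) := ⟨|R| + 1, |R| + 2, by positivity, by linarith⟩
  have hG : ContDiff ℝ 1 fun z => χ z • F z := χ.contDiff.smul hF
  have hc : HasCompactSupport fun z => χ z • F z := χ.hasCompactSupport.smul_right
  obtain ⟨K, hK⟩ := hG.lipschitzWith_of_hasCompactSupport hc one_ne_zero
  obtain ⟨L, hL⟩ := hc.exists_bound_of_continuous hG.continuous
  refine ⟨_, K, L, hK, hL, fun z hz => ?_⟩
  have : χ z = 1 := χ.one_of_mem_closedBall (by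
    rw [mem_closedBall_zero_iff]
    change ‖z‖ ≤ |R| + 1
    linarith [le_abs_self R])
  simp [this]

theorem IsControlledCurve.exists_norm_le {F : X × V → X} {w : ℝ → V} {y : ℝ → X}
    (hy : IsControlledCurve F w y) (hw : ContinuousOn w (Icc 0 1)) :
    ∃ R : ℝ, 0 ≤ R ∧ ∀ t ∈ Icc (0 : ℝ) 1, ‖(y t, w t)‖ ≤ R := by
  obtain ⟨R, hR⟩ := (isCompact_Icc (a := (0 : ℝ)) (b := 1)).exists_bound_of_continuousOn
    (hy.continuousOn.prodMk hw)
  exact ⟨R, (norm_nonneg _).trans (hR 0 (left_mem_Icc.2 zero_le_one)), hR⟩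

/-- Both curves stay in a bounded set, where `F` coincides with a globally Lipschitz map; equal
controls then force equal solutions. -/
theorem IsControlledCurve.eqOn {F : X × V → X} (hF : ContDiff ℝ 1 F) {w : ℝ → V} {y₁ y₂ : ℝ → X}
    (hw : ContinuousOn w (Icc 0 1)) (h₁ : IsControlledCurve F w y₁)
    (h₂ : IsControlledCurve F w y₂) (h0 : y₁ 0 = y₂ 0) : EqOn y₁ y₂ (Icc 0 1) := by
  obtain ⟨R₁, hR₁, hb₁⟩ := h₁.exists_norm_le hw
  obtain ⟨R₂, hR₂, hb₂⟩ := h₂.exists_norm_le hw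
  obtain ⟨G, K, L, hK, -, hG⟩ := hF.exists_lipschitzWith_eqOn_closedBall (R₁ + R₂)
  intro t ht
  have := norm_sub_le_of_isControlledCurve hK (w₁ := w) (w₂ := w) (D := 0)
    (fun s hs => by rw [hG _ ((hb₁ s hs).trans (by linarith))]; exact h₁ s hs)
    (fun s hs => by rw [hG _ ((hb₂ s hs).trans (by linarith))]; exact h₂ s hs) h0 (by simp) t ht
  rw [mul_zero] at this
  exact sub_eq_zero.1 (norm_le_zero_iff.1 this)

/-- Near a given solution on `[0, 1]`, a controlled equation is solvable on `[0, 1]`, with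
Lipschitz dependence on the control. -/
theorem IsControlledCurve.exists_solution_map {F : X × V → X} (hF : ContDiff ℝ 1 F) {v : ℝ → V}
    {y : ℝ → X} (hv : ContinuousOn v (Icc 0 1)) (hy : IsControlledCurve F v y) :
    ∃ (δ K : ℝ) (Φ : (ℝ → V) → ℝ → X), 0 < δ ∧ 0 ≤ K ∧
      (∀ w, ContinuousOn w (Icc 0 1) → (∀ t ∈ Icc (0 : ℝ) 1, ‖w t - v t‖ ≤ δ) →
        Φ w 0 = y 0 ∧ IsControlledCurve F w (Φ w)) ∧
      (∀ t ∈ Icc (0 : ℝ) 1, Φ v t = y t) ∧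
      ∀ w₁ w₂ D, ContinuousOn w₁ (Icc 0 1) → ContinuousOn w₂ (Icc 0 1) →
        (∀ t ∈ Icc (0 : ℝ) 1, ‖w₁ t - w₂ t‖ ≤ D) →
        ∀ t ∈ Icc (0 : ℝ) 1, ‖Φ w₁ t - Φ w₂ t‖ ≤ K * D := by
  classical
  obtain ⟨R, hR0, hR⟩ := hy.exists_norm_le hv
  -- The truncated equation is solvable for every continuous control. The margin `1` around the
  -- given solution is where it agrees with the original equation.
  obtain ⟨G, K, L, hK, hL, hG⟩ := hF.exists_lipschitzWith_eqOn_closedBall (R + 1)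
  have hyG : IsControlledCurve G v y := fun s hs => by
    rw [hG _ ((hR s hs).trans (by linarith))]; exact hy s hs
  have hex : ∀ w : ℝ → V, ∃ z : ℝ → X, ContinuousOn w (Icc 0 1) →
      z 0 = y 0 ∧ IsControlledCurve G w z := fun w => by
    by_cases hw : ContinuousOn w (Icc 0 1)
    · obtain ⟨z, hz⟩ := exists_isControlledCurve_of_lipschitzWith hK hL hw (y 0)
      exact ⟨z, fun _ => hz⟩
    · exact ⟨0, fun h => absurd h hw⟩
  choose Φ hΦ using hex
  have hlip : ∀ w₁ w₂ D, ContinuousOn w₁ (Icc 0 1) → ContinuousOn w₂ (Icc 0 1) →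
        (∀ t ∈ Icc (0 : ℝ) 1, ‖w₁ t - w₂ t‖ ≤ D) →
        ∀ t ∈ Icc (0 : ℝ) 1, ‖Φ w₁ t - Φ w₂ t‖ ≤ K * Real.exp K * D := fun w₁ w₂ D h₁ h₂ hD =>
    norm_sub_le_of_isControlledCurve hK (hΦ w₁ h₁).2 (hΦ w₂ h₂).2
      ((hΦ w₁ h₁).1.trans (hΦ w₂ h₂).1.symm) hD
  have hvy : ∀ t ∈ Icc (0 : ℝ) 1, Φ v t = y t := fun t ht => by
    have := norm_sub_le_of_isControlledCurve hK (hΦ v hv).2 hyG (hΦ v hv).1 (D := 0) (by simp) t ht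
    rw [mul_zero] at this
    exact sub_eq_zero.1 (norm_le_zero_iff.1 this)
  have hK0 : (0 : ℝ) ≤ K := K.2
  -- With this `δ` both the control and the state move by at most `1`, so the solution stays where
  -- `G = F`.
  refine ⟨1 / (1 + K * Real.exp K), K * Real.exp K, Φ, by positivity, by positivity,
    fun w hw hwv => ⟨(hΦ w hw).1, fun t ht => ?_⟩, hvy, hlip⟩
  have h1 := hlip w v _ hw hv hwv t ht
  rw [hvy t ht] at h1
  have h2 : ‖((Φ w t, w t) : X × V) - (y t, v t)‖ ≤ 1 := by
    rw [Prod.mk_sub_mk, Prod.norm_def]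
    refine max_le (h1.trans ?_) ((hwv t ht).trans ?_)
    · rw [mul_one_div]; exact div_le_one_of_le₀ (by linarith) (by positivity)
    · exact div_le_one_of_le₀ (le_add_of_nonneg_right (by positivity)) (by positivity)
  have h3 : ‖((Φ w t, w t) : X × V)‖ ≤ R + 1 := by
    have := norm_le_norm_add_norm_sub' ((Φ w t, w t) : X × V) (y t, v t)
    linarith [hR t ht]
  rw [← hG _ h3]
  exact (hΦ w hw).2 t ht

/-- Existence for inhomogeneous linear equations on `[0, 1]`. -/
theorem exists_linear_ode_solution {A : ℝ → X →L[ℝ] X} {β : ℝ → X}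
    (hA : ContinuousOn A (Icc 0 1)) (hβ : ContinuousOn β (Icc 0 1)) (x : X) :
    ∃ z : ℝ → X, z 0 = x ∧
      ∀ t ∈ Icc (0 : ℝ) 1, HasDerivWithinAt z (A t (z t) + β t) (Icc 0 1) t := by
  -- The pair `(A, β)` is regarded as a control. For `β = 0` the zero curve is a solution, so the
  -- equation is solvable on all of `[0, 1]` for small `β`, and linearity removes the smallness.
  set F : X × ((X →L[ℝ] X) × X) → X := fun q => q.2.1 q.1 + q.2.2 with hFdef
  have hF : ContDiff ℝ 1 F := by
    refine (ContDiff.clm_apply ?_ contDiff_fst).add ?_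
    · exact contDiff_fst.comp contDiff_snd
    · exact contDiff_snd.comp contDiff_snd
  have h0 : IsControlledCurve F (fun t => (A t, (0 : X))) (fun _ => (0 : X)) := fun t _ => by
    have : F (0, (A t, 0)) = 0 := by simp [hFdef]
    rw [this]
    exact hasDerivWithinAt_const _ _ _
  obtain ⟨δ, -, Φ, hδ, -, hΦ, -, -⟩ := h0.exists_solution_map hF (hA.prodMk continuousOn_const)
  have hβ' : ContinuousOn (fun t => A t x + β t) (Icc 0 1) :=
    (hA.clm_apply continuousOn_const).add hβ
  obtain ⟨N, hN⟩ := (isCompact_Icc (a := (0 : ℝ)) (b := 1)).exists_bound_of_continuousOn hβ'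
  -- The factor `s` brings `A x + β`, the inhomogeneity in the equation for `z - x`, within `δ` of
  -- zero; the solution is divided by `s` at the end.
  set s : ℝ := δ / (|N| + 1) with hs
  have hs0 : 0 < s := by positivity
  have h1 := hΦ (fun t => (A t, s • (A t x + β t))) (hA.prodMk (hβ'.const_smul s)) (fun t ht => by
    simp only [Prod.mk_sub_mk, sub_self, sub_zero, Prod.norm_mk, norm_zero]
    refine max_le hδ.le ?_
    rw [norm_smul, Real.norm_of_nonneg hs0.le, hs, div_mul_eq_mul_div]
    refine div_le_of_le_mul₀ (by positivity) hδ.le (mul_le_mul_of_nonneg_left ?_ hδ.le)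
    linarith [hN t ht, le_abs_self N])
  refine ⟨fun t => x + s⁻¹ • Φ (fun t => (A t, s • (A t x + β t))) t, by simp only [h1.1, smul_zero, add_zero], fun t ht => ?_⟩
  refine (((h1.2 t ht).const_smul s⁻¹).const_add x).congr_deriv ?_
  simp only [hFdef, smul_add, map_add, map_smul, smul_smul, inv_mul_cancel₀ hs0.ne', one_smul]
  abel

theorem linear_ode_solution_unique {A : ℝ → X →L[ℝ] X} {β : ℝ → X}
    (hA : ContinuousOn A (Icc 0 1)) {z₁ z₂ : ℝ → X} (h0 : z₁ 0 = z₂ 0)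
    (h₁ : ∀ t ∈ Icc (0 : ℝ) 1, HasDerivWithinAt z₁ (A t (z₁ t) + β t) (Icc 0 1) t)
    (h₂ : ∀ t ∈ Icc (0 : ℝ) 1, HasDerivWithinAt z₂ (A t (z₂ t) + β t) (Icc 0 1) t) :
    EqOn z₁ z₂ (Icc 0 1) := by
  obtain ⟨N, hN⟩ := (isCompact_Icc (a := (0 : ℝ)) (b := 1)).exists_bound_of_continuousOn hA
  have hN0 : 0 ≤ N := (norm_nonneg _).trans (hN 0 (left_mem_Icc.2 zero_le_one))
  intro t ht
  have := norm_le_of_norm_deriv_le_unitInterval (e := fun t => z₁ t - z₂ t) hN0 le_rfl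
    (by simp [h0]) (fun s hs => (h₁ s hs).sub (h₂ s hs)) (fun s hs => by
      rw [add_sub_add_right_eq_sub, ← map_sub, add_zero]
      exact (A s).le_of_opNorm_le (hN s hs) _) t ht
  rw [zero_mul] at this
  exact sub_eq_zero.1 (norm_le_zero_iff.1 this)

/-- The linearization of a controlled equation along a solution `y` approximates the differences
of nearby solutions. -/
theorem IsControlledCurve.exists_linearization_bound {F : X × V → X} (hF : ContDiff ℝ 2 F)
    {v : ℝ → V} {y : ℝ → X} (hv : ContinuousOn v (Icc 0 1)) (hy : IsControlledCurve F v y) :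
    ∃ N : ℝ, 0 ≤ N ∧ ∀ (r D : ℝ) (w₁ w₂ : ℝ → V) (z₁ z₂ ζ : ℝ → X), r ≤ 1 →
      IsControlledCurve F w₁ z₁ → IsControlledCurve F w₂ z₂ → z₁ 0 = z₂ 0 → ζ 0 = 0 →
      (∀ t ∈ Icc (0 : ℝ) 1, ‖w₁ t - v t‖ ≤ r ∧ ‖w₂ t - v t‖ ≤ r ∧
        ‖z₁ t - y t‖ ≤ r ∧ ‖z₂ t - y t‖ ≤ r ∧ ‖w₁ t - w₂ t‖ ≤ D ∧ ‖z₁ t - z₂ t‖ ≤ D) →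
      (∀ t ∈ Icc (0 : ℝ) 1,
        HasDerivWithinAt ζ (fderiv ℝ F (y t, v t) (ζ t, w₁ t - w₂ t)) (Icc 0 1) t) →
      ∀ t ∈ Icc (0 : ℝ) 1, ‖z₁ t - z₂ t - ζ t‖ ≤ N * r * D := by
  obtain ⟨R, hR0, hR⟩ := hy.exists_norm_le hv
  set B : Set (X × V) := Metric.closedBall 0 (R + 1) with hB
  have hBc : IsCompact B := isCompact_closedBall _ _
  have hBconv : Convex ℝ B := convex_closedBall _ _
  have hF' : ContDiff ℝ 1 (fderiv ℝ F) := hF.fderiv_right (by norm_num)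
  obtain ⟨K, hK⟩ := hF'.contDiffOn.exists_lipschitzOnWith one_ne_zero hBconv hBc (s := B)
  obtain ⟨M, hM⟩ := hBc.exists_bound_of_continuousOn hF'.continuous.continuousOn
  have hM0 : 0 ≤ M := (norm_nonneg _).trans (hM 0 (by simp [hB]; linarith))
  have hK0 : (0 : ℝ) ≤ K := K.2
  refine ⟨K * Real.exp M, by positivity, fun r D w₁ w₂ z₁ z₂ ζ hr1 h₁ h₂ h0 hζ0 hb hζ t ht => ?_⟩
  have h00 := hb 0 (left_mem_Icc.2 zero_le_one)
  have hr0 : 0 ≤ r := (norm_nonneg _).trans h00.1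
  have hD0 : 0 ≤ D := (norm_nonneg _).trans h00.2.2.2.2.1
  have key := norm_le_of_norm_deriv_le_unitInterval (e := fun t => z₁ t - z₂ t - ζ t) hM0
    (ε := K * r * D) (by positivity) (by simp [h0, hζ0])
    (fun s hs => ((h₁ s hs).sub (h₂ s hs)).sub (hζ s hs)) (fun s hs => ?_) t ht
  · refine key.trans_eq (by ring)
  obtain ⟨b1, b2, b3, b4, b5, b6⟩ := hb s hs
  set q : X × V := (y s, v s) with hq
  have hqB : q ∈ B := mem_closedBall_zero_iff.2 ((hR s hs).trans (le_add_of_nonneg_right zero_le_one))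
  have hmem : ∀ p : X × V, ‖p - q‖ ≤ r → p ∈ B := fun p hp => by
    have := norm_le_norm_add_norm_sub' p q
    simp only [hB, mem_closedBall_zero_iff]
    linarith [hR s hs]
  have hp1 : ‖((z₁ s, w₁ s) : X × V) - q‖ ≤ r := by
    rw [hq, Prod.mk_sub_mk, Prod.norm_def]; exact max_le b3 b1
  have hp2 : ‖((z₂ s, w₂ s) : X × V) - q‖ ≤ r := by
    rw [hq, Prod.mk_sub_mk, Prod.norm_def]; exact max_le b4 b2
  have htay : ‖F (z₁ s, w₁ s) - F (z₂ s, w₂ s) -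
      fderiv ℝ F q ((z₁ s, w₁ s) - (z₂ s, w₂ s))‖ ≤ K * r * D := by
    have := (convex_closedBall q r).norm_image_sub_le_of_norm_hasFDerivWithin_le'
      (f := F) (f' := fderiv ℝ F) (φ := fderiv ℝ F q) (C := K * r)
      (x := (z₂ s, w₂ s)) (y := (z₁ s, w₁ s))
      (fun p _ => ((hF.differentiable (by norm_num)) p).hasFDerivAt.hasFDerivWithinAt)
      (fun p hp => by
        rw [mem_closedBall_iff_norm] at hp
        have := hK.dist_le_mul p (hmem p hp) q hqB
        rw [dist_eq_norm, dist_eq_norm] at this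
        exact this.trans (mul_le_mul_of_nonneg_left hp hK0))
      (by rwa [mem_closedBall_iff_norm]) (by rwa [mem_closedBall_iff_norm])
    refine this.trans (mul_le_mul_of_nonneg_left ?_ (by positivity))
    rw [Prod.mk_sub_mk, Prod.norm_def]
    exact max_le b6 b5
  -- The derivative of the error is the linearization applied to the error plus a Taylor remainder
  -- of size `K r D`, so Grönwall's inequality applies.
  have hsplit : F (z₁ s, w₁ s) - F (z₂ s, w₂ s) - fderiv ℝ F q (ζ s, w₁ s - w₂ s) =
      fderiv ℝ F q (z₁ s - z₂ s - ζ s, 0) + (F (z₁ s, w₁ s) - F (z₂ s, w₂ s) -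
        fderiv ℝ F q ((z₁ s, w₁ s) - (z₂ s, w₂ s))) := by
    have : ((z₁ s, w₁ s) : X × V) - (z₂ s, w₂ s) = (z₁ s - z₂ s - ζ s, 0) + (ζ s, w₁ s - w₂ s) := by
      simp
    rw [this, map_add]
    abel
  change ‖F (z₁ s, w₁ s) - F (z₂ s, w₂ s) - fderiv ℝ F q (ζ s, w₁ s - w₂ s)‖ ≤ _
  rw [hsplit]
  refine (norm_add_le _ _).trans (add_le_add ?_ htay)
  refine ((fderiv ℝ F q).le_of_opNorm_le (hM q hqB) _).trans_eq ?_
  simp [Prod.norm_def]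

end

/-! ### The norm of a Riemannian metric -/

theorem IsRiemannianMetric.nonneg {h : FormField} (hh : IsRiemannianMetric h) (x X : E4) :
    0 ≤ h x X X := by
  rcases eq_or_ne X 0 with rfl | hX
  · simp
  · exact (hh.pos x X hX).le

theorem rnorm_nonneg (h : FormField) (x X : E4) : 0 ≤ rnorm h x X := Real.sqrt_nonneg _

theorem IsRiemannianMetric.rnorm_sq {h : FormField} (hh : IsRiemannianMetric h) (x X : E4) :
    rnorm h x X ^ 2 = h x X X := Real.sq_sqrt (hh.nonneg x X)

theorem rnorm_smul (h : FormField) (x : E4) (c : ℝ) (X : E4) :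
    rnorm h x (c • X) = |c| * rnorm h x X := by
  unfold rnorm
  rw [map_smul, map_smul, smul_apply, smul_eq_mul, smul_eq_mul, ← mul_assoc,
    Real.sqrt_mul (mul_self_nonneg c), Real.sqrt_mul_self_eq_abs]

/-- Cauchy–Schwarz, from the nonnegativity of `h` on `h(X, X) Y - h(X, Y) X`. -/
theorem IsRiemannianMetric.apply_le_rnorm_mul {h : FormField} (hh : IsRiemannianMetric h)
    (x X Y : E4) : h x X Y ≤ rnorm h x X * rnorm h x Y := by
  rcases eq_or_ne X 0 with rfl | hX
  · simp [rnorm]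
  have h1 := hh.pos x X hX
  have h2 := hh.nonneg x (h x X X • Y - h x X Y • X)
  have h3 : h x (h x X X • Y - h x X Y • X) (h x X X • Y - h x X Y • X) =
      h x X X * (h x X X * h x Y Y - h x X Y ^ 2) := by
    simp only [map_sub, map_smul, sub_apply, smul_apply,
      smul_eq_mul, hh.symm x Y X]
    ring
  rw [h3] at h2
  have h4 := nonneg_of_mul_nonneg_right h2 h1
  rw [← hh.rnorm_sq, ← hh.rnorm_sq x Y] at h4
  exact (le_abs_self _).trans <| abs_le_of_sq_le_sq (by nlinarith) (mul_nonneg (rnorm_nonneg _ _ _) (rnorm_nonneg _ _ _))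

theorem IsRiemannianMetric.rnorm_add_le {h : FormField} (hh : IsRiemannianMetric h)
    (x X Y : E4) : rnorm h x (X + Y) ≤ rnorm h x X + rnorm h x Y := by
  refine (le_abs_self _).trans <| abs_le_of_sq_le_sq ?_
    (add_nonneg (rnorm_nonneg _ _ _) (rnorm_nonneg _ _ _))
  rw [add_sq, hh.rnorm_sq, hh.rnorm_sq, hh.rnorm_sq]
  have h1 := hh.apply_le_rnorm_mul x X Y
  simp only [map_add, add_apply, hh.symm x Y X]
  linarith

theorem IsRiemannianMetric.rnorm_eq_zero {h : FormField} (hh : IsRiemannianMetric h)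
    {x X : E4} (hX : rnorm h x X = 0) : X = 0 := by
  by_contra hne
  have := hh.pos x X hne
  rw [← hh.rnorm_sq, hX] at this
  simp at this

theorem continuous_rnorm (h : FormField) (x : E4) : Continuous (rnorm h x) :=
  Real.continuous_sqrt.comp ((h x).continuous.clm_apply continuous_id)

theorem exists_rnorm_le (h : FormField) (x : E4) : ∃ M, 0 ≤ M ∧ ∀ X, rnorm h x X ≤ M * ‖X‖ := by
  refine ⟨Real.sqrt ‖h x‖, Real.sqrt_nonneg _, fun X => ?_⟩
  conv_rhs => rw [← Real.sqrt_mul_self (norm_nonneg X), ← Real.sqrt_mul (norm_nonneg (h x))]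
  refine Real.sqrt_le_sqrt ((le_abs_self _).trans ?_)
  rw [← mul_assoc]
  exact (h x).le_opNorm₂ X X

theorem IsRiemannianMetric.exists_mul_norm_le_rnorm {h : FormField} (hh : IsRiemannianMetric h)
    (x : E4) : ∃ m > 0, ∀ X, m * ‖X‖ ≤ rnorm h x X := by
  obtain ⟨X₀, hX₀, hmin⟩ := (isCompact_sphere (0 : E4) 1).exists_isMinOn
    (NormedSpace.sphere_nonempty.2 zero_le_one) (continuous_rnorm h x).continuousOn
  have h0 : X₀ ≠ 0 := fun h0 => by simp [h0] at hX₀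
  refine ⟨rnorm h x X₀, lt_of_le_of_ne (rnorm_nonneg _ _ _)
    (fun h1 => h0 (hh.rnorm_eq_zero h1.symm)), fun X => ?_⟩
  rcases eq_or_ne X 0 with rfl | hX
  · simp [rnorm]
  have hX' : 0 < ‖X‖ := norm_pos_iff.2 hX
  have h1 : rnorm h x X₀ ≤ rnorm h x (‖X‖⁻¹ • X) :=
    hmin (by simp [norm_smul, hX'.ne'])
  rw [rnorm_smul, abs_of_pos (inv_pos.2 hX')] at h1
  calc _ ≤ ‖X‖⁻¹ * rnorm h x X * ‖X‖ := by gcongr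
    _ = _ := by field_simp

/-! ### The development as a controlled curve -/

/-- The equation of the development: `p' = P v`, `P' = -Γ_p(P v) P`. -/
noncomputable def developmentField (Γ : ConnectionField) (q : (E4 × (E4 →L[ℝ] E4)) × E4) :
    E4 × (E4 →L[ℝ] E4) :=
  (q.1.2 q.2, -((Γ q.1.1 (q.1.2 q.2)).comp q.1.2))

/-- The pair of curve and parallel translation solves a single equation controlled by `v`, which
makes the preceding section applicable. -/
theorem isDevelopment_iff {Γ : ConnectionField} {x₀ : E4} {v p : ℝ → E4} :
    IsDevelopment Γ x₀ v p ↔ ∃ P : ℝ → E4 →L[ℝ] E4, (p 0, P 0) = (x₀, ContinuousLinearMap.id ℝ E4) ∧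
      IsControlledCurve (developmentField Γ) v fun t => (p t, P t) := by
  constructor
  · rintro ⟨h0, P, hp, hP0, hP⟩
    exact ⟨P, by rw [h0, hP0], fun t ht => (hp t ht).prodMk (hP t ht)⟩
  · rintro ⟨P, h0, hy⟩
    refine ⟨congrArg Prod.fst h0, P, fun t ht => ?_, congrArg Prod.snd h0, fun t ht => ?_⟩
    · exact (hasFDerivAt_fst.comp_hasDerivWithinAt t (hy t ht) :)
    · exact (hasFDerivAt_snd.comp_hasDerivWithinAt t (hy t ht) :)

theorem contDiff_developmentField {Γ : ConnectionField} {n : WithTop ℕ∞} (hΓ : ContDiff ℝ n Γ) :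
    ContDiff ℝ n (developmentField Γ) := by
  have h1 : ContDiff ℝ n fun q : (E4 × (E4 →L[ℝ] E4)) × E4 => q.1.2 q.2 :=
    (contDiff_snd.comp contDiff_fst).clm_apply contDiff_snd
  refine h1.prodMk (ContDiff.neg (ContDiff.clm_comp ?_ (contDiff_snd.comp contDiff_fst)))
  exact (hΓ.comp (contDiff_fst.comp contDiff_fst)).clm_apply h1

/-- With `P a` the velocity of the geodesic, `Q a + P b` is the derivative of the variation `ξ`;
differentiating it once more gives the Jacobi equation. -/
theorem fderiv_developmentField {Γ : ConnectionField} (hΓ : ContDiff ℝ 1 Γ) (p a ξ b : E4)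
    (P Q : E4 →L[ℝ] E4) :
    fderiv ℝ (developmentField Γ) ((p, P), a) ((ξ, Q), b) =
      (Q a + P b, -((fderiv ℝ Γ p ξ (P a) + Γ p (Q a + P b)).comp P + (Γ p (P a)).comp Q)) := by
  set Z := (E4 × (E4 →L[ℝ] E4)) × E4
  have hP : HasFDerivAt (fun q : Z => q.1.2)
      ((ContinuousLinearMap.snd ℝ _ _).comp (ContinuousLinearMap.fst ℝ _ _)) ((p, P), a) :=
    ((ContinuousLinearMap.snd ℝ E4 (E4 →L[ℝ] E4)).comp (ContinuousLinearMap.fst ℝ _ E4)).hasFDerivAt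
  have hp : HasFDerivAt (fun q : Z => q.1.1)
      ((ContinuousLinearMap.fst ℝ _ _).comp (ContinuousLinearMap.fst ℝ _ _)) ((p, P), a) :=
    ((ContinuousLinearMap.fst ℝ E4 (E4 →L[ℝ] E4)).comp (ContinuousLinearMap.fst ℝ _ E4)).hasFDerivAt
  have ha : HasFDerivAt (fun q : Z => q.2) (ContinuousLinearMap.snd ℝ _ _) ((p, P), a) :=
    (ContinuousLinearMap.snd ℝ (E4 × (E4 →L[ℝ] E4)) E4).hasFDerivAt
  have hG : HasFDerivAt Γ (fderiv ℝ Γ p) p := (hΓ.differentiable one_ne_zero p).hasFDerivAt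
  have h1 := hP.clm_apply ha
  have hGp : HasFDerivAt (fun q : Z => Γ q.1.1) ((fderiv ℝ Γ p).comp
      ((ContinuousLinearMap.fst ℝ _ _).comp (ContinuousLinearMap.fst ℝ _ _))) ((p, P), a) :=
    HasFDerivAt.comp (g := Γ) (g' := fderiv ℝ Γ p) (f := fun q : Z => q.1.1) ((p, P), a) hG hp
  have h2 := hGp.clm_apply h1
  have h3 := h1.prodMk ((h2.clm_comp hP).neg)
  have h4 : HasFDerivAt (developmentField Γ) _ ((p, P), a) := h3
  rw [h4.fderiv]
  ext1
  · exact add_comm (P b) (Q a)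
  · ext1 X
    change -(Γ p (P a) (Q X) + (Γ p (P b + Q a) + fderiv ℝ Γ p ξ (P a)) (P X)) =
      -((fderiv ℝ Γ p ξ (P a) + Γ p (Q a + P b)) (P X) + Γ p (P a) (Q X))
    rw [add_comm (P b), add_comm (Γ p _), add_comm (Γ p (P a) (Q X))]

theorem continuous_shift (u : C(Icc (0 : ℝ) 1, E4)) (a : E4) : Continuous (shift u a) :=
  (u.continuous.comp continuous_projIcc).add continuous_const

/-- For a prescribed velocity `q` the equation is linear in `P`, hence solvable on the whole
interval. -/
theorem exists_isParallelTranslation {Γ : ConnectionField} (hΓ : Continuous Γ) {p q : ℝ → E4}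
    (hp : ContinuousOn p (Icc 0 1)) (hq : ContinuousOn q (Icc 0 1)) :
    ∃ P : ℝ → E4 →L[ℝ] E4, IsParallelTranslation Γ p q P := by
  have hc : ContinuousOn (fun t => Γ (p t) (q t)) (Icc 0 1) :=
    (hΓ.comp_continuousOn hp).clm_apply hq
  obtain ⟨P, hP0, hP⟩ := exists_linear_ode_solution (X := E4 →L[ℝ] E4)
    (A := fun t => -(ContinuousLinearMap.compL ℝ E4 E4 E4 (Γ (p t) (q t)))) (β := fun _ => 0)
    ((ContinuousLinearMap.compL ℝ E4 E4 E4).continuous.comp_continuousOn hc).neg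
    continuousOn_const (ContinuousLinearMap.id ℝ E4)
  exact ⟨P, hP0, fun t ht => (hP t ht).congr_deriv (by simp)⟩

/-- A geodesic is the development of its constant initial velocity. -/
theorem IsFrameGeodesic.exists_isControlledCurve {Γ : ConnectionField} (hΓ : Continuous Γ)
    {p q : ℝ → E4} (hp : IsFrameGeodesic Γ 1 p q) :
    ∃ P : ℝ → E4 →L[ℝ] E4, P 0 = ContinuousLinearMap.id ℝ E4 ∧
      IsControlledCurve (developmentField Γ) (fun _ => q 0) (fun t => (p t, P t)) ∧
      ∀ t ∈ Icc (0 : ℝ) 1, P t (q 0) = q t := by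
  have hpc : ContinuousOn p (Icc 0 1) := fun t ht => (hp t ht).1.continuousWithinAt
  have hqc : ContinuousOn q (Icc 0 1) := fun t ht => (hp t ht).2.continuousWithinAt
  obtain ⟨P, hP0, hP⟩ := exists_isParallelTranslation hΓ hpc hqc
  -- The geodesic equation says that the velocity is parallel, so uniqueness for linear equations
  -- identifies it with `P t (q 0)`.
  have hPq : EqOn (fun t => P t (q 0)) q (Icc 0 1) :=
    linear_ode_solution_unique (A := fun t => -(Γ (p t) (q t))) (β := fun _ => 0)
      ((hΓ.comp_continuousOn hpc).clm_apply hqc).neg (by simp [hP0])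
      (fun t ht => ((hP t ht).clm_apply (hasDerivWithinAt_const t _ (q 0))).congr_deriv (by simp))
      (fun t ht => (hp t ht).2.congr_deriv (by simp))
  refine ⟨P, hP0, fun t ht => ?_, hPq⟩
  have h1 : P t (q 0) = q t := hPq ht
  change HasDerivWithinAt _ (P t (q 0), -((Γ (p t) (P t (q 0))).comp (P t))) _ t
  rw [h1]
  exact (hp t ht).1.prodMk (hP t ht)

/-- The derivative of the endpoint of the development with respect to a constant control is
invertible at a geodesic whose endpoints are not conjugate. -/
theorem NotConjugateAlong.exists_equiv {Γ : ConnectionField} (hΓ : ContDiff ℝ ∞ Γ)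
    {p q : ℝ → E4} (hconj : NotConjugateAlong Γ 1 p q)
    {P : ℝ → E4 →L[ℝ] E4} (hP0 : P 0 = ContinuousLinearMap.id ℝ E4)
    (hy : IsControlledCurve (developmentField Γ) (fun _ => q 0) (fun t => (p t, P t)))
    (hPq : ∀ t ∈ Icc (0 : ℝ) 1, P t (q 0) = q t) :
    ∃ (L : E4 ≃L[ℝ] E4) (ζ : E4 → ℝ → E4 × (E4 →L[ℝ] E4)), ∀ b, ζ b 0 = 0 ∧ (ζ b 1).1 = L b ∧
      ∀ t ∈ Icc (0 : ℝ) 1, HasDerivWithinAt (ζ b)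
        (fderiv ℝ (developmentField Γ) ((p t, P t), q 0) (ζ b t, b)) (Icc 0 1) t := by
  have hΓ1 : ContDiff ℝ 1 Γ := hΓ.of_le (by exact_mod_cast le_top)
  have hF' : Continuous (fderiv ℝ (developmentField Γ)) :=
    (contDiff_developmentField hΓ).continuous_fderiv (by simp)
  have hDc : ContinuousOn (fun t => fderiv ℝ (developmentField Γ) ((p t, P t), q 0)) (Icc 0 1) :=
    hF'.comp_continuousOn (hy.continuousOn.prodMk continuousOn_const)
  set X := E4 × (E4 →L[ℝ] E4)
  -- An operator-valued equation treats all `b` at once, so that linearity in `b` is built in.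
  obtain ⟨Z, hZ0, hZ⟩ := exists_linear_ode_solution (X := E4 →L[ℝ] X)
    (A := fun t => ContinuousLinearMap.compL ℝ E4 X X
      ((fderiv ℝ (developmentField Γ) ((p t, P t), q 0)).comp (ContinuousLinearMap.inl ℝ X E4)))
    (β := fun t =>
      (fderiv ℝ (developmentField Γ) ((p t, P t), q 0)).comp (ContinuousLinearMap.inr ℝ X E4))
    ((ContinuousLinearMap.compL ℝ E4 X X).continuous.comp_continuousOn
      (hDc.clm_comp continuousOn_const)) (hDc.clm_comp continuousOn_const) 0
  have hζ : ∀ b, ∀ t ∈ Icc (0 : ℝ) 1, HasDerivWithinAt (fun t => Z t b)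
        (fderiv ℝ (developmentField Γ) ((p t, P t), q 0) (Z t b, b)) (Icc 0 1) t := by
    intro b t ht
    refine ((hZ t ht).clm_apply (hasDerivWithinAt_const t _ b)).congr_deriv ?_
    have : ((Z t b, b) : X × E4) = (Z t b, 0) + (0, b) := by simp
    rw [this, map_add]
    simp
  set L₀ : E4 →ₗ[ℝ] E4 :=
    ((ContinuousLinearMap.fst ℝ E4 (E4 →L[ℝ] E4)).comp (Z 1) : E4 →L[ℝ] E4).toLinearMap
  -- For `b` in the kernel, the first component of `Z b` is a Jacobi field vanishing at both ends,
  -- hence zero. Its derivative at time `0` is `b`.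
  have hinj : Function.Injective L₀ := by
    rw [← LinearMap.ker_eq_bot, LinearMap.ker_eq_bot']
    intro b hb
    have h1 : ∀ t ∈ Icc (0 : ℝ) 1, HasDerivWithinAt (fun t => (Z t b).1)
        ((Z t b).2 (q 0) + P t b) (Icc 0 1) t := by
      intro t ht
      have := hζ b t ht
      rw [fderiv_developmentField hΓ1] at this
      exact (hasFDerivAt_fst.comp_hasDerivWithinAt t this :)
    have h2 : ∀ t ∈ Icc (0 : ℝ) 1, HasDerivWithinAt (fun t => (Z t b).2)
        (-((fderiv ℝ Γ (p t) (Z t b).1 (q t) + Γ (p t) ((Z t b).2 (q 0) + P t b)).comp (P t) +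
          (Γ (p t) (q t)).comp (Z t b).2)) (Icc 0 1) t := by
      intro t ht
      have := hζ b t ht
      rw [fderiv_developmentField hΓ1, hPq t ht] at this
      exact (hasFDerivAt_snd.comp_hasDerivWithinAt t this :)
    have h3 : ∀ t ∈ Icc (0 : ℝ) 1, HasDerivWithinAt P (-((Γ (p t) (q t)).comp (P t)))
        (Icc 0 1) t := by
      intro t ht
      have h4 := hasFDerivAt_snd.comp_hasDerivWithinAt t (hy t ht)
      have h5 : HasDerivWithinAt P (-((Γ (p t) (P t (q 0))).comp (P t))) (Icc 0 1) t := h4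
      rwa [hPq t ht] at h5
    have hjac : IsJacobiField Γ 1 p q (fun t => (Z t b).1) fun t => (Z t b).2 (q 0) + P t b := by
      intro t ht
      refine ⟨h1 t ht, ?_⟩
      refine (((h2 t ht).clm_apply (hasDerivWithinAt_const t _ (q 0))).add
        ((h3 t ht).clm_apply (hasDerivWithinAt_const t _ b))).congr_deriv ?_
      simp only [map_zero, add_zero, neg_apply, add_apply, ContinuousLinearMap.comp_apply,
        hPq t ht, map_add]
      abel
    have hzero := hconj _ _ hjac (by simp [hZ0]) hb
    have h00 : (0 : ℝ) ∈ Icc (0 : ℝ) 1 := left_mem_Icc.2 zero_le_one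
    have h6 := (h1 0 h00).congr (fun t ht => (hzero t ht).symm) (hzero 0 h00).symm
    have h7 := (uniqueDiffOn_Icc zero_lt_one 0 h00).eq_deriv _ h6
      (hasDerivWithinAt_const 0 _ (0 : E4))
    simpa [hZ0, hP0] using h7
  refine ⟨(LinearEquiv.ofInjectiveEndo L₀ hinj).toContinuousLinearEquiv, fun b t => Z t b,
    fun b => ⟨by simp [hZ0], rfl, hζ b⟩⟩

/-! ### Solving the endpoint condition near the given geodesic -/

theorem norm_le_of_mem_curveBall {h : FormField} {x : E4} {m r : ℝ} (hm : 0 < m) (hr : 0 ≤ r)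
    (hmul : ∀ X, m * ‖X‖ ≤ rnorm h x X) {u : C(Icc (0 : ℝ) 1, E4)}
    (hu : u ∈ curveBall h x (m * r)) : ‖u‖ ≤ r :=
  (ContinuousMap.norm_le _ hr).2 fun t => le_of_mul_le_mul_left ((hmul _).trans (hu t)) hm

/-- Let `f u a` be the endpoint of `S(u + a)`. On a small ball about `q 0`, and uniformly for small
`u`, `f u` differs from the invertible `L` by a map with Lipschitz constant at most half of `ν =
‖L⁻¹‖⁻¹`. So `f u` is injective there, and its image contains a ball of fixed radius about `f u (q
0)`, which contains the target for small `u`. -/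
theorem IsFrameGeodesic.exists_isAdmissible {Γ : ConnectionField} (hΓ : ContDiff ℝ ∞ Γ)
    {g h : FormField} (hh : IsRiemannianMetric h) {p q : ℝ → E4}
    (hp : IsFrameGeodesic Γ 1 p q) (hconj : NotConjugateAlong Γ 1 p q)
    (hcone : g (p 0) (q 0) (q 0) < 0) {U : Set E4} (hU : IsOpen U)
    (hpU : ∀ t ∈ Icc (0 : ℝ) 1, p t ∈ U) :
    ∃ (ε C : ℝ) (W : Set E4) (κ : C(Icc (0 : ℝ) 1, E4) → E4),
      IsAdmissible Γ g h (p 0) (p 1) (q 0) ε C W κ ∧ DevelopmentsIn Γ h (p 0) ε κ U := by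
  classical
  have hF2 : ContDiff ℝ 2 (developmentField Γ) :=
    contDiff_developmentField (hΓ.of_le (WithTop.coe_le_coe.2 le_top))
  have hF1 : ContDiff ℝ 1 (developmentField Γ) := hF2.of_le (by norm_num)
  obtain ⟨P, hP0, hy, hPq⟩ := hp.exists_isControlledCurve hΓ.continuous
  obtain ⟨L, ζ, hζ⟩ := hconj.exists_equiv hΓ hP0 hy hPq
  obtain ⟨δ, K, Φ, hδ, hK, hΦ, hΦv, hlip⟩ := hy.exists_solution_map hF1 continuousOn_const
  obtain ⟨N, hN, hlin⟩ := hy.exists_linearization_bound hF2 continuousOn_const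
  obtain ⟨m, hm, hmul⟩ := hh.exists_mul_norm_le_rnorm (p 0)
  obtain ⟨M, hM0, hM⟩ := exists_rnorm_le h (p 0)
  set a₀ := q 0 with ha₀
  have hpc : ContinuousOn p (Icc 0 1) := fun t ht => (hp t ht).1.continuousWithinAt
  obtain ⟨τ, hτ, hτU⟩ := (isCompact_Icc.image_of_continuousOn hpc).exists_thickening_subset_open hU
    (by rintro _ ⟨t, ht, rfl⟩; exact hpU t ht)
  obtain ⟨σ, hσ, hσg⟩ : ∃ σ > 0, ∀ a, dist a a₀ < σ → g (p 0) a a < 0 := by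
    have hc : Continuous fun a => g (p 0) a a := (g (p 0)).continuous.clm_apply continuous_id
    exact Metric.eventually_nhds_iff.1 (hc.continuousAt.eventually (gt_mem_nhds hcone))
  set ν : NNReal := ‖(L.symm : E4 →L[ℝ] E4)‖₊⁻¹ with hν
  have hν0 : 0 < ν := by
    rw [hν]
    refine inv_pos.2 (pos_iff_ne_zero.2 (nnnorm_ne_zero_iff.2 fun h0 => ?_))
    obtain ⟨x, hx⟩ := exists_ne (0 : E4)
    have := congrArg (fun A : E4 →L[ℝ] E4 => A x) h0
    simp at this
    exact hx this
  have hν0' : (0 : ℝ) < ν := hν0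
  -- the radius of the neighbourhood of the initial vector
  obtain ⟨r, hr, hr1, hr2, hr3, hr4, hr5⟩ : ∃ r > 0, 2 * r ≤ δ ∧ (K + 1) * (2 * r) ≤ 1 ∧
      N * ((K + 1) * (2 * r)) * (K + 1) ≤ ν / 2 ∧ r < σ ∧ K * (2 * r) < τ := by
    have hc : ∀ f : ℝ → ℝ, Continuous f → ∀ b, f 0 < b → ∀ᶠ r in 𝓝[>] (0:ℝ), f r < b :=
      fun f hf b hb => (hf.continuousAt.eventually (gt_mem_nhds hb)).filter_mono nhdsWithin_le_nhds
    obtain ⟨r, h1, h2, h3, h4, h5, h6⟩ := (eventually_mem_nhdsWithin.and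
      ((hc (fun r => 2 * r) (by fun_prop) δ (by simpa)).and
      ((hc (fun r => (K + 1) * (2 * r)) (by fun_prop) 1 (by simp)).and
      ((hc (fun r => N * ((K + 1) * (2 * r)) * (K + 1)) (by fun_prop) (ν / 2)
        (by simpa using hν0')).and
      ((hc (fun r => r) (by fun_prop) σ hσ).and
      (hc (fun r => K * (2 * r)) (by fun_prop) τ (by simpa))))))).exists
    exact ⟨r, h1, h2.le, h3.le, h4.le, h5, h6⟩
  -- A perturbation `u` of size `s` moves the endpoint by at most `K s`, which must not exceed the
  -- radius `(ν - ν/2) r` covered by `f u`.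
  obtain ⟨s, hs, hsr, hsν⟩ : ∃ s > 0, s ≤ r ∧ K * s ≤ ν / 2 * r := by
    refine ⟨min r (ν / 2 * r / (K + 1)), by positivity, min_le_left _ _, ?_⟩
    calc K * min r (ν / 2 * r / (K + 1)) ≤ (K + 1) * (ν / 2 * r / (K + 1)) := by
          gcongr
          · linarith
          · exact min_le_right _ _
      _ = _ := by field_simp
  set f : C(Icc (0 : ℝ) 1, E4) → E4 → E4 := fun u a => (Φ (shift u a) 1).1 with hf
  have hcont : ∀ u a, ContinuousOn (shift u a) (Icc 0 1) := fun u a =>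
    (continuous_shift u a).continuousOn
  have hclose : ∀ (u : C(Icc (0 : ℝ) 1, E4)) a, ‖u‖ ≤ s → a ∈ Metric.closedBall a₀ r →
      ∀ t, ‖shift u a t - a₀‖ ≤ 2 * r := by
    intro u a hu ha t
    rw [mem_closedBall_iff_norm] at ha
    rw [shift, add_sub_assoc]
    refine (norm_add_le _ _).trans ?_
    linarith [u.norm_coe_le_norm (projIcc 0 1 zero_le_one t)]
  have hsol : ∀ (u : C(Icc (0 : ℝ) 1, E4)) a, ‖u‖ ≤ s → a ∈ Metric.closedBall a₀ r →
      Φ (shift u a) 0 = (p 0, ContinuousLinearMap.id ℝ E4) ∧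
        IsControlledCurve (developmentField Γ) (shift u a) (Φ (shift u a)) := by
    intro u a hu ha
    have := hΦ _ (hcont u a) fun t _ => (hclose u a hu ha t).trans hr1
    rwa [hP0] at this
  have hnear : ∀ (u : C(Icc (0 : ℝ) 1, E4)) a, ‖u‖ ≤ s → a ∈ Metric.closedBall a₀ r →
      ∀ t ∈ Icc (0 : ℝ) 1, ‖Φ (shift u a) t - (p t, P t)‖ ≤ K * (2 * r) := by
    intro u a hu ha t ht
    rw [← hΦv t ht]
    exact hlip _ _ _ (hcont u a) continuousOn_const (fun t _ => hclose u a hu ha t) t ht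
  have h11 : (1 : ℝ) ∈ Icc (0 : ℝ) 1 := right_mem_Icc.2 zero_le_one
  -- developments are the curves found above
  have hdev : ∀ (u : C(Icc (0 : ℝ) 1, E4)) a, ‖u‖ ≤ s → a ∈ Metric.closedBall a₀ r →
      ∀ c, IsDevelopment Γ (p 0) (shift u a) c →
        ∀ t ∈ Icc (0 : ℝ) 1, c t = (Φ (shift u a) t).1 := by
    intro u a hu ha c hc t ht
    obtain ⟨Q, hQ0, hQ⟩ := isDevelopment_iff.1 hc
    have := hQ.eqOn hF1 (hcont u a) (hsol u a hu ha).2 (hQ0.trans (hsol u a hu ha).1.symm) ht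
    exact congrArg Prod.fst this
  have hdevTo : ∀ (u : C(Icc (0 : ℝ) 1, E4)) a, ‖u‖ ≤ s → a ∈ Metric.closedBall a₀ r →
      (DevelopsTo Γ (p 0) (p 1) u a ↔ f u a = p 1) := by
    intro u a hu ha
    constructor
    · rintro ⟨c, hc, hc1⟩
      rw [← hc1, hdev u a hu ha c hc 1 h11]
    · intro hfa
      exact ⟨fun t => (Φ (shift u a) t).1, isDevelopment_iff.2
        ⟨fun t => (Φ (shift u a) t).2, (hsol u a hu ha).1, (hsol u a hu ha).2⟩, hfa⟩
  have happ : ∀ u : C(Icc (0 : ℝ) 1, E4), ‖u‖ ≤ s →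
      ApproximatesLinearOn (f u) (L : E4 →L[ℝ] E4) (Metric.closedBall a₀ r) (ν / 2) := by
    intro u hu a ha b hb
    have hab : ∀ t, shift u a t - shift u b t = a - b := fun t => by simp [shift]
    have hD : ∀ t ∈ Icc (0 : ℝ) 1,
        ‖Φ (shift u a) t - Φ (shift u b) t‖ ≤ K * ‖a - b‖ :=
      hlip _ _ _ (hcont u a) (hcont u b) fun t _ => by rw [hab]
    have hrle : 2 * r ≤ (K + 1) * (2 * r) := by nlinarith
    -- The factor `K + 1` dominates both the bound `1` for controls and the bound `K` for states.
    have h1 := hlin ((K + 1) * (2 * r)) ((K + 1) * ‖a - b‖) (shift u a) (shift u b) (Φ (shift u a))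
      (Φ (shift u b)) (ζ (a - b)) hr2 (hsol u a hu ha).2 (hsol u b hu hb).2
      ((hsol u a hu ha).1.trans (hsol u b hu hb).1.symm) (hζ _).1
      (fun t ht => ⟨(hclose u a hu ha t).trans hrle, (hclose u b hu hb t).trans hrle,
        (hnear u a hu ha t ht).trans (by nlinarith), (hnear u b hu hb t ht).trans (by nlinarith),
        by rw [hab]; nlinarith [norm_nonneg (a - b)],
        (hD t ht).trans (by nlinarith [norm_nonneg (a - b)])⟩)
      (fun t ht => by rw [hab]; exact (hζ _).2.2 t ht) 1 h11
    have h2 : ‖f u a - f u b - L (a - b)‖ ≤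
        ‖Φ (shift u a) 1 - Φ (shift u b) 1 - ζ (a - b) 1‖ := by
      rw [← (hζ (a - b)).2.1]
      exact norm_fst_le (Φ (shift u a) 1 - Φ (shift u b) 1 - ζ (a - b) 1)
    refine (h2.trans h1).trans ?_
    push_cast
    nlinarith [mul_le_mul_of_nonneg_right hr3 (norm_nonneg (a - b))]
  have hνlt : ν / 2 < ν := NNReal.half_lt_self hν0.ne'
  have hflip : ∀ (u u' : C(Icc (0 : ℝ) 1, E4)) a, ‖f u a - f u' a‖ ≤ K * ‖u - u'‖ := by
    intro u u' a
    refine (norm_fst_le (Φ (shift u a) 1 - Φ (shift u' a) 1)).trans ?_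
    refine hlip _ _ _ (hcont u a) (hcont u' a) (fun t _ => ?_) 1 h11
    rw [shift, shift, add_sub_add_right_eq_sub]
    exact (u - u').norm_coe_le_norm (projIcc 0 1 zero_le_one t)
  have ha₀r : a₀ ∈ Metric.closedBall a₀ r := Metric.mem_closedBall_self hr.le
  have hf0 : f 0 a₀ = p 1 := by
    have h1 : shift 0 a₀ = fun _ => a₀ := by ext1 t; simp [shift]
    simp only [hf]
    rw [h1, hΦv 1 h11]
  have hex : ∀ u : C(Icc (0 : ℝ) 1, E4), ∃ a, ‖u‖ ≤ s → a ∈ Metric.closedBall a₀ r ∧ f u a = p 1 := by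
    intro u
    by_cases hu : ‖u‖ ≤ s
    · have h1 := (happ u hu).surjOn_closedBall_of_nonlinearRightInverse
        L.toNonlinearRightInverse hr.le Subset.rfl
      obtain ⟨a, ha, ha'⟩ := h1 (a := p 1) (by
        rw [← hf0, mem_closedBall_iff_norm]
        refine (hflip 0 u a₀).trans ?_
        rw [zero_sub, norm_neg]
        have h2 : ((L.toNonlinearRightInverse.nnnorm : ℝ))⁻¹ = ν := by
          rw [hν, NNReal.coe_inv]; rfl
        rw [h2]
        push_cast
        nlinarith [mul_le_mul_of_nonneg_left hu hK])
      exact ⟨a, fun _ => ⟨ha, ha'⟩⟩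
    · exact ⟨0, fun h0 => absurd h0 hu⟩
  choose κ hκ using hex
  have hball : ∀ u ∈ curveBall h (p 0) (m * s), ‖u‖ ≤ s := fun u hu =>
    norm_le_of_mem_curveBall hm hs.le hmul hu
  -- As `m ‖X‖ ≤ rnorm h (p 0) X ≤ M ‖X‖`, the radius `m * s` forces `‖u‖ ≤ s`, and `M * (‖a₀‖ + r)`
  -- bounds the `h`-norm on `W`.
  refine ⟨m * s, M * (‖a₀‖ + r), Metric.closedBall a₀ r, κ, ⟨mul_pos hm hs,
    Metric.closedBall_mem_nhds _ hr, Metric.isBounded_closedBall, fun u hu => (hκ u (hball u hu)).1,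
    fun u hu => ?_, fun u hu a ha hd => ?_, ?_, fun u hu => ?_, fun u hu => ?_⟩, fun u hu c hc t ht => ?_⟩
  · exact (hdevTo u _ (hball u hu) (hκ u (hball u hu)).1).2 (hκ u (hball u hu)).2
  · refine (happ u (hball u hu)).injOn (Or.inr hνlt) ha (hκ u (hball u hu)).1 ?_
    rw [(hκ u (hball u hu)).2, (hdevTo u a (hball u hu) ha).1 hd]
  -- The inverse of `f u` has Lipschitz constant `(ν - ν/2)⁻¹`. Since `f u (κ u) = f u' (κ u')`,
  -- only the change of `f` with `u` at the point `κ u'` remains.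
  · have hL : LipschitzOnWith ((ν - ν / 2)⁻¹ * K.toNNReal) κ (curveBall h (p 0) (m * s)) := by
      refine LipschitzOnWith.of_dist_le_mul fun u hu u' hu' => ?_
      have h1 := ((happ u (hball u hu)).antilipschitz (Or.inr hνlt)).le_mul_dist
        ⟨κ u, (hκ u (hball u hu)).1⟩ ⟨κ u', (hκ u' (hball u' hu')).1⟩
      simp only [Set.domRestrict_apply, Subtype.dist_eq] at h1
      rw [(hκ u (hball u hu)).2, ← (hκ u' (hball u' hu')).2, dist_comm (f u' (κ u')),
        dist_eq_norm (f u _)] at h1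
      refine h1.trans ?_
      rw [NNReal.coe_mul, Real.coe_toNNReal K hK, mul_assoc, dist_eq_norm]
      exact mul_le_mul_of_nonneg_left (hflip u u' _) (NNReal.coe_nonneg _)
    exact hL.continuousOn
  · exact hσg _ ((Metric.mem_closedBall.1 (hκ u (hball u hu)).1).trans_lt hr4)
  · refine (hM _).trans (mul_le_mul_of_nonneg_left ?_ hM0)
    have h1 := mem_closedBall_iff_norm.1 (hκ u (hball u hu)).1
    have h2 := norm_le_norm_add_norm_sub' (κ u) a₀
    linarith
  · rw [hdev u _ (hball u hu) (hκ u (hball u hu)).1 c hc t ht]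
    refine hτU (Metric.mem_thickening_iff.2 ⟨p t, ⟨t, ht, rfl⟩, ?_⟩)
    rw [dist_eq_norm]
    refine lt_of_le_of_lt ?_ hr5
    exact (norm_fst_le (Φ (shift u (κ u)) t - (p t, P t))).trans
      (hnear u _ (hball u hu) (hκ u (hball u hu)).1 t ht)

section

set_option maxSynthPendingDepth 3

/-! ### The tensor `G` -/

/-- The derivative of `g` is taken as an independent variable, which serves both fixed and moving
base points. -/
theorem continuous_koszul_aux : Continuous fun q : (E4 →L[ℝ] E4 →L[ℝ] E4 →L[ℝ] ℝ) × E4 =>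
    (1 / 2 : ℝ) • (q.1 q.2 q.2 + q.1 q.2 q.2 - (q.1.flip q.2).flip q.2) := by
  have h1 : Continuous fun q : (E4 →L[ℝ] E4 →L[ℝ] E4 →L[ℝ] ℝ) × E4 => q.1 q.2 q.2 :=
    (continuous_fst.clm_apply continuous_snd).clm_apply continuous_snd
  have h2 : Continuous fun q : (E4 →L[ℝ] E4 →L[ℝ] E4 →L[ℝ] ℝ) × E4 => q.1.flip q.2 :=
    ((ContinuousLinearMap.flipₗᵢ ℝ E4 E4 (E4 →L[ℝ] ℝ)).continuous.comp continuous_fst).clm_apply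
      continuous_snd
  have h3 : Continuous fun q : (E4 →L[ℝ] E4 →L[ℝ] E4 →L[ℝ] ℝ) × E4 => (q.1.flip q.2).flip q.2 :=
    ((ContinuousLinearMap.flipₗᵢ ℝ E4 E4 ℝ).continuous.comp h2).clm_apply continuous_snd
  exact ((h1.add h1).sub h3).const_smul (1 / 2 : ℝ)

theorem continuous_koszul (g : FormField) (x : E4) : Continuous fun X => koszul g x X X :=
  continuous_koszul_aux.comp (f := fun X : E4 => (fderiv ℝ g x, X)) (Continuous.prodMk_right _)

theorem koszul_smul (g : FormField) (x : E4) (c : ℝ) (X : E4) :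
    koszul g x (c • X) (c • X) = c ^ 2 • koszul g x X X := by
  ext Z
  simp [koszul]
  ring

theorem gravTensor_smul (Γ : ConnectionField) (g : FormField) (x : E4) (c : ℝ) (X : E4) :
    gravTensor Γ g x (c • X) (c • X) = c ^ 2 • gravTensor Γ g x X X := by
  simp only [gravTensor, christoffel, koszul_smul, map_smul, smul_apply, smul_sub, smul_smul, sq]

theorem continuous_gravTensor (Γ : ConnectionField) (g : FormField) (x : E4) :
    Continuous fun X => gravTensor Γ g x X X := by
  unfold gravTensor christoffel
  exact ((Γ x).continuous.clm_apply continuous_id).sub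
    ((g x).inverse.continuous.comp (continuous_koszul g x))

/-- By quadratic homogeneity it suffices to treat unit vectors. The unit ball of `h` is compact, so
the `sSup` in `gravNorm` is over a bounded set and is a genuine upper bound. -/
theorem IsRiemannianMetric.rnorm_gravTensor_le {h : FormField} (hh : IsRiemannianMetric h)
    (Γ : ConnectionField) (g : FormField) (x X : E4) :
    rnorm h x (gravTensor Γ g x X X) ≤ gravNorm Γ g h x * rnorm h x X ^ 2 := by
  rcases eq_or_ne X 0 with rfl | hX
  · have := gravTensor_smul Γ g x 0 0
    simp at this
    simp [this, rnorm]
  have hX' : rnorm h x X ≠ 0 := fun h0 => hX (hh.rnorm_eq_zero h0)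
  have hpos : 0 < rnorm h x X := lt_of_le_of_ne (rnorm_nonneg _ _ _) hX'.symm
  obtain ⟨m, hm, hmul⟩ := hh.exists_mul_norm_le_rnorm x
  have hc : IsCompact {X | rnorm h x X ≤ 1} := by
    refine Metric.isCompact_of_isClosed_isBounded
      (isClosed_le (continuous_rnorm h x) continuous_const)
      ((Metric.isBounded_closedBall (x := (0 : E4)) (r := 1 / m)).subset fun Y hY => ?_)
    rw [mem_closedBall_zero_iff, le_div_iff₀ hm, mul_comm]
    exact (hmul Y).trans hY
  have hbdd : BddAbove ((fun X => rnorm h x (gravTensor Γ g x X X)) '' {X | rnorm h x X ≤ 1}) :=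
    hc.bddAbove_image ((continuous_rnorm h x).comp (continuous_gravTensor Γ g x)).continuousOn
  have h1 : rnorm h x (gravTensor Γ g x ((rnorm h x X)⁻¹ • X) ((rnorm h x X)⁻¹ • X)) ≤
      gravNorm Γ g h x := by
    refine le_csSup hbdd ⟨_, ?_, rfl⟩
    change rnorm h x _ ≤ 1
    rw [rnorm_smul, abs_of_pos (inv_pos.2 hpos), inv_mul_cancel₀ hX']
  rw [gravTensor_smul, rnorm_smul, abs_of_nonneg (sq_nonneg _)] at h1
  calc rnorm h x (gravTensor Γ g x X X)
      = (rnorm h x X)⁻¹ ^ 2 * rnorm h x (gravTensor Γ g x X X) * rnorm h x X ^ 2 := by field_simp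
    _ ≤ _ := by gcongr

/-- Joint continuity of the Christoffel map of a smooth nondegenerate form. -/
theorem continuousAt_christoffel {g : FormField} {O : Set E4} (hO : IsOpen O)
    (hg : ContDiffOn ℝ 1 g O) {x : E4} (hx : x ∈ O) (hinv : (g x).IsInvertible) (X : E4) :
    ContinuousAt (fun q : E4 × E4 => christoffel g q.1 q.2 q.2) (x, X) := by
  have h1 : ContinuousAt (fun q : E4 × E4 => g q.1) (x, X) :=
    ContinuousAt.comp (f := Prod.fst) (x := (x, X)) (hg.continuousOn.continuousAt (hO.mem_nhds hx)) continuousAt_fst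
  have h2 : ContinuousAt (fun q : E4 × E4 => fderiv ℝ g q.1) (x, X) :=
    ContinuousAt.comp (f := Prod.fst) (x := (x, X))
      ((hg.continuousOn_fderiv_of_isOpen hO le_rfl).continuousAt (hO.mem_nhds hx)) continuousAt_fst
  have hX : ContinuousAt (fun q : E4 × E4 => q.2) (x, X) := continuousAt_snd
  have h3 : ContinuousAt (fun q : E4 × E4 => koszul g q.1 q.2 q.2) (x, X) :=
    ContinuousAt.comp (f := fun q : E4 × E4 => (fderiv ℝ g q.1, q.2))
      continuous_koszul_aux.continuousAt (h2.prodMk hX)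
  have h4 : ContinuousAt (fun q : E4 × E4 => (g q.1).inverse) (x, X) := by
    obtain ⟨e, he⟩ := hinv
    have : ContinuousAt (ContinuousLinearMap.inverse (R := ℝ) (M := E4) (M₂ := E4 →L[ℝ] ℝ)) (g x) := by
      rw [← he]; exact (contDiffAt_map_inverse (n := 0) e).continuousAt
    exact ContinuousAt.comp (f := fun q : E4 × E4 => g q.1) this h1
  exact h4.clm_apply h3

/-! ### Parallel translation of a metric connection -/

theorem eq_of_hasDerivWithinAt_zero {X : Type*} [NormedAddCommGroup X] [NormedSpace ℝ X]
    {f : ℝ → X} (hf : ∀ t ∈ Icc (0 : ℝ) 1, HasDerivWithinAt f 0 (Icc 0 1) t) :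
    ∀ t ∈ Icc (0 : ℝ) 1, f t = f 0 := by
  intro t ht
  have := norm_le_of_norm_deriv_le_unitInterval (e := fun t => f t - f 0) (e' := fun _ => 0) le_rfl
    le_rfl (sub_self _) (fun s hs => (hf s hs).sub_const _) (by simp) t ht
  rw [zero_mul] at this
  exact sub_eq_zero.1 (norm_le_zero_iff.1 this)

/-- Compatibility says exactly that the derivative of `h(P X, P Y)` along the curve vanishes. -/
theorem IsMetricConnection.apply_parallelTranslation {Γ : ConnectionField} {h : FormField}
    (hΓh : IsMetricConnection Γ h) (hh : ContDiff ℝ ∞ h) {p p' : ℝ → E4} {P : ℝ → E4 →L[ℝ] E4}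
    (hp : ∀ t ∈ Icc (0 : ℝ) 1, HasDerivWithinAt p (p' t) (Icc 0 1) t)
    (hP : IsParallelTranslation Γ p p' P) (X Y : E4) :
    ∀ t ∈ Icc (0 : ℝ) 1, h (p t) (P t X) (P t Y) = h (p 0) X Y := by
  intro t ht
  have := eq_of_hasDerivWithinAt_zero (f := fun t => h (p t) (P t X) (P t Y)) (fun s hs => ?_) t ht
  · simpa [hP.1] using this
  have h1 : HasDerivWithinAt (fun t => h (p t)) (fderiv ℝ h (p s) (p' s)) (Icc 0 1) s :=
    ((hh.differentiable (by simp) (p s)).hasFDerivAt).comp_hasDerivWithinAt s (hp s hs)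
  have h2 : ∀ Z, HasDerivWithinAt (fun t => P t Z) (-(Γ (p s) (p' s) (P s Z))) (Icc 0 1) s :=
    fun Z => ((hP.2 s hs).clm_apply (hasDerivWithinAt_const s _ Z)).congr_deriv (by simp)
  refine ((h1.clm_apply (h2 X)).clm_apply (h2 Y)).congr_deriv ?_
  have h3 := hΓh (p s) (P s X) (P s Y) (p' s)
  simp only [add_apply, map_neg, neg_apply]
  rw [h3]
  ring

/-! ### The domain of the fixed point map -/

/-- Pairing the integral `X` with itself gives `‖X‖² = ∫ h(X, f) ≤ ‖X‖ ε |t - s|` by Cauchy–Schwarz.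
-/
theorem IsRiemannianMetric.rnorm_integral_le {h : FormField} (hh : IsRiemannianMetric h) (x : E4)
    {f : ℝ → E4} (hf : Continuous f) {ε : ℝ} (hε : ∀ t, rnorm h x (f t) ≤ ε) (s t : ℝ) :
    rnorm h x (∫ τ in s..t, f τ) ≤ ε * |t - s| := by
  set X := ∫ τ in s..t, f τ with hX
  rcases eq_or_ne (rnorm h x X) 0 with h0 | h0
  · rw [h0]
    exact mul_nonneg ((rnorm_nonneg _ _ _).trans (hε 0)) (abs_nonneg _)
  have hpos : 0 < rnorm h x X := lt_of_le_of_ne (rnorm_nonneg _ _ _) h0.symm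
  have h1 : h x X X = ∫ τ in s..t, h x X (f τ) := by
    conv_lhs => rw [hX]
    exact ((h x X).intervalIntegral_comp_comm (hf.intervalIntegrable s t)).symm
  have h2 : ‖∫ τ in s..t, h x X (f τ)‖ ≤ rnorm h x X * ε * |t - s| := by
    refine intervalIntegral.norm_integral_le_of_norm_le_const fun τ _ => ?_
    rw [Real.norm_eq_abs, abs_le]
    have h3 := hh.apply_le_rnorm_mul x X (f τ)
    have h4 := hh.apply_le_rnorm_mul x (-X) (f τ)
    have h5 : rnorm h x (-X) = rnorm h x X := by simpa using rnorm_smul h x (-1) X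
    rw [h5, map_neg, neg_apply] at h4
    have h6 := mul_le_mul_of_nonneg_left (hε τ) hpos.le
    constructor <;> linarith
  rw [← h1, ← hh.rnorm_sq, Real.norm_of_nonneg (sq_nonneg _), sq, mul_assoc] at h2
  exact le_of_mul_le_mul_left h2 hpos

/-- The compact convex set of curves in which the fixed point is found. -/
theorem IsRiemannianMetric.isCompact_lipschitz {h : FormField} (hh : IsRiemannianMetric h)
    (x : E4) {ε : ℝ} (hε : 0 ≤ ε) :
    IsCompact {u : C(Icc (0 : ℝ) 1, E4) | u 0 = 0 ∧
      ∀ s t : Icc (0 : ℝ) 1, rnorm h x (u t - u s) ≤ ε * |(t - s : ℝ)|} := by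
  obtain ⟨m, hm, hmul⟩ := hh.exists_mul_norm_le_rnorm x
  have hlip : ∀ f : Icc (0 : ℝ) 1 → E4, (∀ s t : Icc (0 : ℝ) 1, rnorm h x (f t - f s) ≤ ε * |(t - s : ℝ)|) →
      LipschitzWith (ε / m).toNNReal f := fun f hf => LipschitzWith.of_dist_le_mul fun s t => by
    rw [Real.coe_toNNReal _ (by positivity), dist_eq_norm, div_mul_eq_mul_div, le_div_iff₀ hm,
      mul_comm]
    exact (hmul _).trans (hf t s)
  refine ArzelaAscoli.isCompact_of_equicontinuous _ ?_ ?_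
  -- The Lipschitz condition forces continuity, so the set of underlying functions is cut out of a
  -- compact product of balls by closed pointwise conditions.
  · have himage : ContinuousMap.toFun '' {u : C(Icc (0 : ℝ) 1, E4) | u 0 = 0 ∧
        ∀ s t : Icc (0 : ℝ) 1, rnorm h x (u t - u s) ≤ ε * |(t - s : ℝ)|} =
        {f | f 0 = 0 ∧ ∀ s t : Icc (0 : ℝ) 1, rnorm h x (f t - f s) ≤ ε * |(t - s : ℝ)|} := by
      ext f
      constructor
      · rintro ⟨u, hu, rfl⟩; exact hu
      · intro hf
        exact ⟨⟨f, (hlip f hf.2).continuous⟩, hf, rfl⟩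
    rw [himage]
    refine (isCompact_univ_pi (X := fun _ : Icc (0 : ℝ) 1 => E4)
      (s := fun _ => Metric.closedBall 0 (ε / m)) fun _ => isCompact_closedBall _ _).of_isClosed_subset
      ?_ fun f hf t _ => ?_
    · simp only [ofPred_and, ofPred_forall]
      refine (isClosed_eq (continuous_apply _) continuous_const).inter
        (isClosed_iInter fun s => isClosed_iInter fun t => isClosed_le
          ((continuous_rnorm h x).comp (g := rnorm h x)
            (f := fun f : Icc (0 : ℝ) 1 → E4 => f t - f s)
            ((continuous_apply t).sub (continuous_apply s))) continuous_const)
    · rw [mem_closedBall_zero_iff, le_div_iff₀ hm, mul_comm]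
      have h1 := (hmul (f t - f 0)).trans (hf.2 0 t)
      rw [hf.1, sub_zero] at h1
      refine h1.trans (mul_le_of_le_one_right hε ?_)
      rw [abs_le]
      have := t.2.1
      have := t.2.2
      constructor <;> simp <;> linarith
  · exact (LipschitzWith.uniformEquicontinuous _ (ε / m).toNNReal
      fun u => hlip _ u.2.2).equicontinuous

theorem IsRiemannianMetric.convex_lipschitz {h : FormField} (hh : IsRiemannianMetric h)
    (x : E4) (ε : ℝ) :
    Convex ℝ {u : C(Icc (0 : ℝ) 1, E4) | u 0 = 0 ∧
      ∀ s t : Icc (0 : ℝ) 1, rnorm h x (u t - u s) ≤ ε * |(t - s : ℝ)|} := by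
  rintro u ⟨hu0, hu⟩ w ⟨hw0, hw⟩ a b ha hb hab
  refine ⟨by simp [hu0, hw0], fun s t => ?_⟩
  have h1 : (a • u + b • w) t - (a • u + b • w) s = a • (u t - u s) + b • (w t - w s) := by
    simp only [ContinuousMap.add_apply, ContinuousMap.smul_apply]
    module
  rw [h1]
  refine (hh.rnorm_add_le _ _ _).trans ?_
  rw [rnorm_smul, rnorm_smul, abs_of_nonneg ha, abs_of_nonneg hb]
  calc _ ≤ a * (ε * |(t : ℝ) - s|) + b * (ε * |(t : ℝ) - s|) := by
        gcongr
        · exact hu s t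
        · exact hw s t
    _ = _ := by rw [← add_mul, hab, one_mul]

/-- The square of the velocity is constant along a geodesic of the Levi-Civita connection. -/
theorem apply_velocity_eq {g : FormField} {p q : ℝ → E4}
    (hg : ∀ t ∈ Icc (0 : ℝ) 1, DifferentiableAt ℝ g (p t))
    (hinv : ∀ t ∈ Icc (0 : ℝ) 1, (g (p t)).IsInvertible)
    (hsymm : ∀ t ∈ Icc (0 : ℝ) 1, ∀ X Y, g (p t) X Y = g (p t) Y X)
    (hp : ∀ t ∈ Icc (0 : ℝ) 1, SolvesGeodesicEq (christoffel g) (Icc 0 1) p q t) :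
    ∀ t ∈ Icc (0 : ℝ) 1, g (p t) (q t) (q t) = g (p 0) (q 0) (q 0) := by
  refine eq_of_hasDerivWithinAt_zero (f := fun t => g (p t) (q t) (q t)) fun t ht => ?_
  have h1 : HasDerivWithinAt (fun t => g (p t)) (fderiv ℝ g (p t) (q t)) (Icc 0 1) t :=
    (hg t ht).hasFDerivAt.comp_hasDerivWithinAt t (hp t ht).1
  refine ((h1.clm_apply (hp t ht).2).clm_apply (hp t ht).2).congr_deriv ?_
  -- With all arguments equal the Koszul formula reduces to half of `∂_q g(q, q)`, and the two
  -- acceleration terms cancel the derivative of `g`.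
  have h2 := christoffel_spec g (p t) (q t) (q t) (q t) (hinv t ht)
  simp only [add_apply, map_neg, neg_apply]
  rw [hsymm t ht (q t), h2]
  ring

/-! ### The fixed point argument -/

/-- The derivative `P⁻¹ G_p(P v, P v)` that the control `v` must have for its development to be a
geodesic of the Levi-Civita connection. -/
noncomputable def pulledBackForce (Γ : ConnectionField) (g : FormField)
    (q : (E4 × (E4 →L[ℝ] E4)) × E4) : E4 :=
  q.1.2.inverse (gravTensor Γ g q.1.1 (q.1.2 q.2) (q.1.2 q.2))

theorem continuousAt_pulledBackForce {Γ : ConnectionField} (hΓ : Continuous Γ) {g : FormField}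
    {O : Set E4} (hO : IsOpen O) (hg : ContDiffOn ℝ 1 g O) {q : (E4 × (E4 →L[ℝ] E4)) × E4}
    (hx : q.1.1 ∈ O) (hinv : (g q.1.1).IsInvertible) (hP : q.1.2.IsInvertible) :
    ContinuousAt (pulledBackForce Γ g) q := by
  have hp : ContinuousAt (fun q : (E4 × (E4 →L[ℝ] E4)) × E4 => q.1.1) q := by fun_prop
  have hw : ContinuousAt (fun q : (E4 × (E4 →L[ℝ] E4)) × E4 => q.1.2 q.2) q := by fun_prop
  have h1 : ContinuousAt (fun q : (E4 × (E4 →L[ℝ] E4)) × E4 =>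
      christoffel g q.1.1 (q.1.2 q.2) (q.1.2 q.2)) q :=
    ContinuousAt.comp (f := fun q : (E4 × (E4 →L[ℝ] E4)) × E4 => (q.1.1, q.1.2 q.2))
      (continuousAt_christoffel hO hg hx hinv _) (hp.prodMk hw)
  have h2 : ContinuousAt (fun q : (E4 × (E4 →L[ℝ] E4)) × E4 =>
      Γ q.1.1 (q.1.2 q.2) (q.1.2 q.2)) q :=
    ((hΓ.continuousAt.comp hp).clm_apply hw).clm_apply hw
  have h3 : ContinuousAt (fun q : (E4 × (E4 →L[ℝ] E4)) × E4 => q.1.2.inverse) q := by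
    obtain ⟨e, he⟩ := hP
    have : ContinuousAt (ContinuousLinearMap.inverse (R := ℝ) (M := E4) (M₂ := E4)) q.1.2 := by
      rw [← he]; exact (contDiffAt_map_inverse (n := 0) e).continuousAt
    exact ContinuousAt.comp (f := fun q : (E4 × (E4 →L[ℝ] E4)) × E4 => q.1.2) this (by fun_prop)
  exact h3.clm_apply (h2.sub h1)

theorem isInvertible_of_isometry {h : FormField} (hh : IsRiemannianMetric h) {x y : E4}
    {P : E4 →L[ℝ] E4} (hP : ∀ X, h y (P X) (P X) = h x X X) : P.IsInvertible := by
  have hinj : Function.Injective (P : E4 →ₗ[ℝ] E4) := by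
    rw [← LinearMap.ker_eq_bot, LinearMap.ker_eq_bot']
    intro X hX
    by_contra hne
    have := hh.pos x X hne
    rw [← hP X] at this
    have h0 : P X = 0 := hX
    simp [h0] at this
  exact ⟨(LinearEquiv.ofInjectiveEndo _ hinj).toContinuousLinearEquiv, rfl⟩

/-- The existence of a geodesic of the Levi-Civita connection, from Schauder's theorem. -/
theorem IsAdmissible.exists_geodesic {Γ : ConnectionField} (hΓ : ContDiff ℝ ∞ Γ)
    {g h : FormField} (hh : IsRiemannianMetric h) (hΓh : IsMetricConnection Γ h)
    {O : Set E4} (hO : IsOpen O) (hg : ContDiffOn ℝ ∞ g O)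
    (hinv : ∀ x ∈ O, (g x).IsInvertible) (hsymm : ∀ x ∈ O, ∀ X Y, g x X Y = g x Y X)
    {x₀ x₁ X₀ : E4} {ε C : ℝ} {W : Set E4} {κ : C(Icc (0 : ℝ) 1, E4) → E4}
    (hκ : IsAdmissible Γ g h x₀ x₁ X₀ ε C W κ) {V : Set E4} (hVO : V ⊆ O)
    (hV : DevelopmentsIn Γ h x₀ ε κ V)
    (hG : ∀ x ∈ V, gravNorm Γ g h x < ε / (ε + C) ^ 2) :
    ∃ p q : ℝ → E4, p 0 = x₀ ∧ p 1 = x₁ ∧ ∀ t ∈ Icc (0 : ℝ) 1, p t ∈ O ∧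
      SolvesGeodesicEq (christoffel g) (Icc 0 1) p q t ∧ g (p t) (q t) (q t) < 0 := by
  classical
  have h01 : (0 : ℝ) ∈ Icc (0 : ℝ) 1 := left_mem_Icc.2 zero_le_one
  have hg1 : ContDiffOn ℝ 1 g O := hg.of_le (WithTop.coe_le_coe.2 le_top)
  have hF1 : ContDiff ℝ 1 (developmentField Γ) :=
    contDiff_developmentField (hΓ.of_le (WithTop.coe_le_coe.2 le_top))
  have hε := hκ.eps_pos
  -- The zero curve lies in `U_ε`, so `C` bounds a norm; hence `ε + C > 0`.
  have hC : 0 ≤ C := (rnorm_nonneg _ _ _).trans (hκ.norm_le 0 fun t => by simp [rnorm, hε.le])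
  -- the developments and their properties
  have hex : ∀ u : C(Icc (0 : ℝ) 1, E4), ∃ (p : ℝ → E4) (P : ℝ → E4 →L[ℝ] E4),
      u ∈ curveBall h x₀ ε →
        IsDevelopment Γ x₀ (shift u (κ u)) p ∧ p 1 = x₁ ∧
        (p 0, P 0) = (x₀, ContinuousLinearMap.id ℝ E4) ∧
        IsControlledCurve (developmentField Γ) (shift u (κ u)) fun t => (p t, P t) := by
    intro u
    by_cases hu : u ∈ curveBall h x₀ ε
    · obtain ⟨p, hp, hp1⟩ := hκ.develops u hu
      obtain ⟨P, hP0, hP⟩ := isDevelopment_iff.1 hp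
      exact ⟨p, P, fun _ => ⟨hp, hp1, hP0, hP⟩⟩
    · exact ⟨0, 0, fun h => absurd h hu⟩
  choose p P hpP using hex
  set v : C(Icc (0 : ℝ) 1, E4) → ℝ → E4 := fun u => shift u (κ u) with hv
  have hvc : ∀ u, Continuous (v u) := fun u => continuous_shift u _
  have hpV : ∀ u ∈ curveBall h x₀ ε, ∀ t ∈ Icc (0 : ℝ) 1, p u t ∈ V := fun u hu =>
    hV u hu _ (hpP u hu).1
  have hdp : ∀ u ∈ curveBall h x₀ ε, ∀ t ∈ Icc (0 : ℝ) 1,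
      HasDerivWithinAt (p u) (P u t (v u t)) (Icc 0 1) t := fun u hu t ht =>
    (hasFDerivAt_fst.comp_hasDerivWithinAt t ((hpP u hu).2.2.2 t ht) :)
  have hdP : ∀ u ∈ curveBall h x₀ ε,
      IsParallelTranslation Γ (p u) (fun t => P u t (v u t)) (P u) := fun u hu =>
    ⟨congrArg Prod.snd (hpP u hu).2.2.1, fun t ht =>
      (hasFDerivAt_snd.comp_hasDerivWithinAt t ((hpP u hu).2.2.2 t ht) :)⟩
  have hp0 : ∀ u ∈ curveBall h x₀ ε, p u 0 = x₀ := fun u hu =>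
    congrArg Prod.fst (hpP u hu).2.2.1
  have hiso : ∀ u ∈ curveBall h x₀ ε, ∀ t ∈ Icc (0 : ℝ) 1, ∀ X,
      h (p u t) (P u t X) (P u t X) = h x₀ X X := fun u hu t ht X => by
    rw [hΓh.apply_parallelTranslation hh.smooth (hdp u hu) (hdP u hu) X X t ht, hp0 u hu]
  have hPinv : ∀ u ∈ curveBall h x₀ ε, ∀ t ∈ Icc (0 : ℝ) 1, (P u t).IsInvertible :=
    fun u hu t ht => isInvertible_of_isometry hh (hiso u hu t ht)
  have hHc : ∀ u ∈ curveBall h x₀ ε, ∀ t ∈ Icc (0 : ℝ) 1,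
      ContinuousAt (pulledBackForce Γ g) ((p u t, P u t), v u t) := fun u hu t ht =>
    continuousAt_pulledBackForce hΓ.continuous hO hg1 (hVO (hpV u hu t ht))
      (hinv _ (hVO (hpV u hu t ht))) (hPinv u hu t ht)
  -- the integrand of the fixed point map
  set f : C(Icc (0 : ℝ) 1, E4) → ℝ → E4 := fun u s =>
    IccExtend zero_le_one (fun t : Icc (0 : ℝ) 1 =>
      pulledBackForce Γ g ((p u t, P u t), v u t)) s with hf
  have hfI : ∀ u, ∀ t ∈ Icc (0 : ℝ) 1, f u t = pulledBackForce Γ g ((p u t, P u t), v u t) :=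
    fun u t ht => IccExtend_of_mem zero_le_one _ ht
  have hyc : ∀ u ∈ curveBall h x₀ ε,
      ContinuousOn (fun t => ((p u t, P u t), v u t)) (Icc 0 1) := fun u hu =>
    (hpP u hu).2.2.2.continuousOn.prodMk (hvc u).continuousOn
  have hfc : ∀ u ∈ curveBall h x₀ ε, Continuous (f u) := by
    intro u hu
    refine Continuous.Icc_extend' ?_
    rw [continuous_iff_continuousAt]
    intro t
    exact ContinuousAt.comp (f := fun t : Icc (0 : ℝ) 1 => ((p u t, P u t), v u t))
      (hHc u hu t t.2) (continuousOn_iff_continuous_domRestrict.1 (hyc u hu)).continuousAt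
  -- The smallness of `G` enters here: `P` is an isometry and `‖u + κ u‖ ≤ ε + C`, so the quadratic
  -- bound for `G` gives at most `ε`.
  have hfε : ∀ u ∈ curveBall h x₀ ε, ∀ s, rnorm h x₀ (f u s) ≤ ε := by
    intro u hu s
    set t := projIcc (0 : ℝ) 1 zero_le_one s with ht
    have h1 : f u s = (P u t).inverse
        (gravTensor Γ g (p u t) (P u t (v u t)) (P u t (v u t))) := rfl
    have h2 : P u t (f u s) = gravTensor Γ g (p u t) (P u t (v u t)) (P u t (v u t)) := by
      rw [h1]
      obtain ⟨e, he⟩ := hPinv u hu t t.2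
      rw [← he, ContinuousLinearMap.inverse_equiv]
      simp
    have h3 : rnorm h x₀ (f u s) = rnorm h (p u t) (P u t (f u s)) := by
      rw [rnorm, rnorm, hiso u hu t t.2]
    have h4 : rnorm h (p u t) (P u t (v u t)) = rnorm h x₀ (v u t) := by
      rw [rnorm, rnorm, hiso u hu t t.2]
    have h5 : rnorm h x₀ (v u t) ≤ ε + C :=
      (hh.rnorm_add_le _ _ _).trans (add_le_add (hu _) (hκ.norm_le u hu))
    rw [h3, h2]
    refine (hh.rnorm_gravTensor_le Γ g _ _).trans ?_
    rw [h4]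
    have h6 : 0 < ε + C := by linarith
    calc _ ≤ ε / (ε + C) ^ 2 * rnorm h x₀ (v u t) ^ 2 :=
          mul_le_mul_of_nonneg_right (hG _ (hpV u hu t t.2)).le (sq_nonneg _)
      _ ≤ ε / (ε + C) ^ 2 * (ε + C) ^ 2 :=
          mul_le_mul_of_nonneg_left (pow_le_pow_left₀ (rnorm_nonneg _ _ _) h5 2) (by positivity)
      _ = ε := by field_simp
  have hAex : ∀ u : C(Icc (0 : ℝ) 1, E4), ∃ w : C(Icc (0 : ℝ) 1, E4), u ∈ curveBall h x₀ ε →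
      ∀ t : Icc (0 : ℝ) 1, w t = ∫ s in (0 : ℝ)..t, f u s := by
    intro u
    by_cases hu : u ∈ curveBall h x₀ ε
    · exact ⟨⟨fun t => ∫ s in (0 : ℝ)..t, f u s,
        (intervalIntegral.continuous_primitive (fun a b => (hfc u hu).intervalIntegrable a b) 0).comp
          continuous_subtype_val⟩, fun _ t => rfl⟩
    · exact ⟨0, fun h => absurd h hu⟩
  choose A hA using hAex
  -- On the unit interval these conditions imply `u ∈ U_ε`; moreover `u 0 = 0` makes `κ u` the
  -- initial velocity of the development.
  set K : Set C(Icc (0 : ℝ) 1, E4) := {u | u 0 = 0 ∧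
      ∀ s t : Icc (0 : ℝ) 1, rnorm h x₀ (u t - u s) ≤ ε * |(t - s : ℝ)|} with hK
  have hKball : K ⊆ curveBall h x₀ ε := by
    rintro u ⟨hu0, hu⟩ t
    have h1 := hu 0 t
    rw [hu0, sub_zero] at h1
    refine h1.trans (mul_le_of_le_one_right hε.le ?_)
    rw [abs_le]
    have := t.2.1
    have := t.2.2
    constructor <;> simp <;> linarith
  have hmaps : MapsTo A K K := by
    intro u hu
    have hub := hKball hu
    refine ⟨by rw [hA u hub]; simp, fun s t => ?_⟩
    rw [hA u hub, hA u hub, intervalIntegral.integral_interval_sub_left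
      ((hfc u hub).intervalIntegrable _ _) ((hfc u hub).intervalIntegrable _ _)]
    exact hh.rnorm_integral_le x₀ (hfc u hub) (hfε u hub) s t
  have hAc : ContinuousOn A K := by
    intro u₀ hu₀
    have hub₀ := hKball hu₀
    obtain ⟨δ, L, Φ, hδ, hL, hΦ, hΦv, hlip⟩ :=
      (hpP u₀ hub₀).2.2.2.exists_solution_map hF1 (hvc u₀).continuousOn
    rw [ContinuousWithinAt, Metric.tendsto_nhds]
    intro η hη
    -- Continuity of the force at the points of one compact curve gives a single `δ₁` comparing it
    -- there with all nearby points.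
    have huc := (isCompact_Icc.image_of_continuousOn (hyc u₀ hub₀)).uniformContinuousAt_of_continuousAt
      (pulledBackForce Γ g) (by rintro _ ⟨t, ht, rfl⟩; exact hHc u₀ hub₀ t ht)
      (Metric.dist_mem_uniformity (half_pos hη))
    obtain ⟨δ₁, hδ₁, hδ₁'⟩ := Metric.mem_uniformity_dist.1 huc
    obtain ⟨D, hD, hDδ, hD1, hLD⟩ : ∃ D > 0, D ≤ δ ∧ D < δ₁ ∧ L * D < δ₁ := by
      refine ⟨min δ (δ₁ / (L + 1) / 2), by positivity, min_le_left _ _, ?_, ?_⟩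
      · refine (min_le_right _ _).trans_lt ((half_lt_self (by positivity)).trans_le ?_)
        exact div_le_self hδ₁.le (by linarith)
      · calc L * min δ (δ₁ / (L + 1) / 2) ≤ (L + 1) * (δ₁ / (L + 1) / 2) := by
              gcongr
              · linarith
              · exact min_le_right _ _
          _ = δ₁ / 2 := by field_simp
          _ < δ₁ := half_lt_self hδ₁
    have hκc : ContinuousWithinAt κ K u₀ := (hκ.continuousOn u₀ hub₀).mono hKball
    filter_upwards [Metric.tendsto_nhds.1 hκc (D / 2) (half_pos hD),
      mem_nhdsWithin_of_mem_nhds (Metric.ball_mem_nhds u₀ (half_pos hD)),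
      self_mem_nhdsWithin] with u h1 h2 hu
    have hub := hKball hu
    have hvD : ∀ t ∈ Icc (0 : ℝ) 1, ‖v u t - v u₀ t‖ ≤ D := by
      intro t _
      have h3 : v u t - v u₀ t = (u - u₀) (projIcc 0 1 zero_le_one t) + (κ u - κ u₀) := by
        simp only [hv, shift, ContinuousMap.sub_apply]; abel
      have h4 := (u - u₀).norm_coe_le_norm (projIcc 0 1 zero_le_one t)
      rw [dist_eq_norm] at h1
      rw [Metric.mem_ball, dist_eq_norm] at h2
      rw [h3]
      refine (norm_add_le _ _).trans ?_
      linarith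
    obtain ⟨hΦ0, hΦ1⟩ := hΦ (v u) (hvc u).continuousOn fun t ht => (hvD t ht).trans hDδ
    -- By uniqueness the chosen development of `u` is the one given by the solution map around `u₀`,
    -- which is Lipschitz in the control.
    have heq := (hpP u hub).2.2.2.eqOn hF1 (hvc u).continuousOn hΦ1
      ((hpP u hub).2.2.1.trans ((hpP u₀ hub₀).2.2.1.symm.trans hΦ0.symm))
    have hclose : ∀ s, ‖f u s - f u₀ s‖ ≤ η / 2 := by
      intro s
      set t := projIcc (0 : ℝ) 1 zero_le_one s with ht
      have h3 : dist (((p u₀ t, P u₀ t), v u₀ t) : (E4 × (E4 →L[ℝ] E4)) × E4)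
          ((p u t, P u t), v u t) < δ₁ := by
        rw [dist_comm, Prod.dist_eq]
        refine max_lt ?_ ?_
        · have h5 : ((p u t, P u t) : E4 × (E4 →L[ℝ] E4)) = Φ (v u) t := heq t.2
          rw [h5, ← hΦv t t.2, dist_eq_norm]
          exact (hlip _ _ _ (hvc u).continuousOn (hvc u₀).continuousOn hvD t t.2).trans_lt hLD
        · rw [dist_eq_norm]; exact (hvD t t.2).trans_lt hD1
      have h4 := hδ₁' h3 ⟨t, t.2, rfl⟩
      rw [← dist_eq_norm, dist_comm]
      exact le_of_lt h4
    rw [dist_eq_norm]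
    refine lt_of_le_of_lt ((ContinuousMap.norm_le _ (half_pos hη).le).2 fun t => ?_)
      (half_lt_self hη)
    rw [ContinuousMap.sub_apply, hA u hub, hA u₀ hub₀, ← intervalIntegral.integral_sub
      ((hfc u hub).intervalIntegrable _ _) ((hfc u₀ hub₀).intervalIntegrable _ _)]
    refine (intervalIntegral.norm_integral_le_of_norm_le_const fun s _ => hclose s).trans ?_
    rw [sub_zero, abs_of_nonneg t.2.1]
    exact mul_le_of_le_one_right (half_pos hη).le t.2.2
  obtain ⟨u, hu, hAu⟩ := (hh.isCompact_lipschitz x₀ hε.le).exists_fixedPoint_of_mapsTo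
    (hh.convex_lipschitz x₀ ε) ⟨0, by simp [rnorm, hε.le, mul_nonneg]⟩ hAc hmaps
  have hub := hKball hu
  -- the development of the fixed point is a geodesic
  have hvd : ∀ t ∈ Icc (0 : ℝ) 1, HasDerivWithinAt (v u)
      (pulledBackForce Γ g ((p u t, P u t), v u t)) (Icc 0 1) t := by
    intro t ht
    rw [← hfI u t ht]
    have h1 : HasDerivAt (fun t => (∫ s in (0 : ℝ)..t, f u s) + κ u) (f u t) t :=
      ((hfc u hub).integral_hasStrictDerivAt 0 t).hasDerivAt.add_const _
    have h2 : ∀ s ∈ Icc (0 : ℝ) 1, v u s = (∫ s in (0 : ℝ)..s, f u s) + κ u := by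
      intro s hs
      simp only [hv, shift]
      have h3 := hA u hub ⟨s, hs⟩
      rw [hAu] at h3
      rw [projIcc_of_mem zero_le_one hs, h3]
    exact h1.hasDerivWithinAt.congr h2 (h2 t ht)
  -- The derivative of `P v` is `-Γ(P v, P v) + G(P v, P v)`, in which `Γ` cancels and minus the
  -- Christoffel map of `g` remains.
  have hgeo : ∀ t ∈ Icc (0 : ℝ) 1, SolvesGeodesicEq (christoffel g) (Icc 0 1) (p u)
      (fun t => P u t (v u t)) t := by
    intro t ht
    refine ⟨hdp u hub t ht, (((hdP u hub).2 t ht).clm_apply (hvd t ht)).congr_deriv ?_⟩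
    have h2 : P u t (pulledBackForce Γ g ((p u t, P u t), v u t)) =
        gravTensor Γ g (p u t) (P u t (v u t)) (P u t (v u t)) := by
      obtain ⟨e, he⟩ := hPinv u hub t ht
      simp only [pulledBackForce]
      rw [← he, ContinuousLinearMap.inverse_equiv]
      simp
    rw [h2, gravTensor, neg_apply, ContinuousLinearMap.comp_apply]
    abel
  have hpO : ∀ t ∈ Icc (0 : ℝ) 1, p u t ∈ O := fun t ht => hVO (hpV u hub t ht)
  refine ⟨p u, fun t => P u t (v u t), hp0 u hub, (hpP u hub).2.1, fun t ht =>
    ⟨hpO t ht, hgeo t ht, ?_⟩⟩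
  -- The conserved square of the velocity is evaluated at time `0`, where the velocity is `κ u`.
  rw [apply_velocity_eq (fun t ht => (hg1.differentiableOn one_ne_zero).differentiableAt
    (hO.mem_nhds (hpO t ht))) (fun t ht => hinv _ (hpO t ht)) (fun t ht => hsymm _ (hpO t ht))
    hgeo t ht, hp0 u hub, (hdP u hub).1]
  have h0 : v u 0 = κ u := by
    simp only [hv, shift]
    rw [projIcc_of_mem zero_le_one h01]
    have : u ⟨0, h01⟩ = 0 := hu.1
    rw [this, zero_add]
  rw [h0]
  exact hκ.timelike u hub

/-! ### Affine reparametrization -/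

theorem SolvesGeodesicEq.comp_mul {Γ : E4 → E4 → E4 → E4}
    (hΓ : ∀ x (c : ℝ) X, Γ x (c • X) (c • X) = c ^ 2 • Γ x X X) {J J' : Set ℝ} {y v : ℝ → E4}
    {c t : ℝ} (h : SolvesGeodesicEq Γ J y v (c * t)) (hJ : MapsTo (fun s => c * s) J' J) :
    SolvesGeodesicEq Γ J' (fun s => y (c * s)) (fun s => c • v (c * s)) t := by
  have hc : HasDerivWithinAt (fun s => c * s) c J' t := by
    simpa using ((hasDerivAt_id t).const_mul c).hasDerivWithinAt
  refine ⟨h.1.scomp t hc hJ, ((h.2.scomp t hc hJ).const_smul c).congr_deriv ?_⟩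
  rw [hΓ, smul_neg, smul_neg, smul_smul, sq]

theorem christoffel_smul (g : FormField) (x : E4) (c : ℝ) (X : E4) :
    christoffel g x (c • X) (c • X) = c ^ 2 • christoffel g x X X := by
  simp only [christoffel, koszul_smul, map_smul]

theorem mapsTo_mul_Icc {c a b : ℝ} (hc : 0 ≤ c) (hab : c * a = b) :
    MapsTo (fun s => c * s) (Icc 0 a) (Icc 0 b) := fun s hs =>
  ⟨mul_nonneg hc hs.1, by rw [← hab]; exact mul_le_mul_of_nonneg_left hs.2 hc⟩

theorem IsFrameGeodesic.comp_mul {Γ : ConnectionField} {T : ℝ} (hT : 0 < T) {γ γ' : ℝ → E4}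
    (hγ : IsFrameGeodesic Γ T γ γ') :
    IsFrameGeodesic Γ 1 (fun t => γ (T * t)) fun t => T • γ' (T * t) := fun t ht =>
  SolvesGeodesicEq.comp_mul (fun x c X => by simp [smul_smul, sq])
    (hγ _ (mapsTo_mul_Icc hT.le (mul_one T) ht)) (mapsTo_mul_Icc hT.le (mul_one T))

/-- A Jacobi field on `[0, 1]`, precomposed with `s ↦ T⁻¹ s`, is one along the original geodesic
with the same end values. -/
theorem NotConjugateAlong.comp_mul {Γ : ConnectionField} {T : ℝ} (hT : 0 < T) {γ γ' : ℝ → E4}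
    (h : NotConjugateAlong Γ T γ γ') :
    NotConjugateAlong Γ 1 (fun t => γ (T * t)) fun t => T • γ' (T * t) := by
  intro J J' hJ h0 h1 t ht
  have hTT : T⁻¹ * T = 1 := inv_mul_cancel₀ hT.ne'
  have hmaps := mapsTo_mul_Icc (inv_nonneg.2 hT.le) hTT
  have hjac : IsJacobiField Γ T γ γ' (fun s => J (T⁻¹ * s)) fun s => T⁻¹ • J' (T⁻¹ * s) := by
    intro s hs
    have hc : HasDerivWithinAt (fun s => T⁻¹ * s) T⁻¹ (Icc 0 T) s := by
      simpa using ((hasDerivAt_id s).const_mul T⁻¹).hasDerivWithinAt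
    obtain ⟨h2, h3⟩ := hJ _ (hmaps hs)
    refine ⟨h2.scomp s hc hmaps, ((h3.scomp s hc hmaps).const_smul T⁻¹).congr_deriv ?_⟩
    have h4 : T * (T⁻¹ * s) = s := by rw [← mul_assoc, mul_inv_cancel₀ hT.ne', one_mul]
    simp only [h4, map_smul, smul_apply, smul_neg, smul_add, smul_smul]
    congr 3
    · rw [show T⁻¹ * (T⁻¹ * (T * T)) = 1 by field_simp, one_smul]
    · rw [show T⁻¹ * (T⁻¹ * T) = T⁻¹ by field_simp]
    · rw [show T⁻¹ * (T⁻¹ * T) = T⁻¹ by field_simp]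
  have h5 := h _ _ hjac (by simpa using h0) (by simpa [hTT] using h1) (T * t)
    (mapsTo_mul_Icc hT.le (mul_one T) ht)
  simpa [← mul_assoc, hTT] using h5

/-! ### The Lorentz form in a chart -/

section Manifold

variable {M : Type*} [TopologicalSpace M] [ChartedSpace E4 M]

theorem minkowski_comm (X Y : E4) : minkowski X Y = minkowski Y X := by
  unfold minkowski; ring

theorem eq_zero_of_minkowski {X : E4} (hX : ∀ Y, minkowski X Y = 0) : X = 0 := by
  ext i
  have := hX (EuclideanSpace.single i 1)
  fin_cases i <;> simpa [minkowski] using this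

theorem LorentzMetric.symm (g : LorentzMetric M) (x : M) (X Y : TangentSpace (𝓡 4) x) :
    g.form x X Y = g.form x Y X := by
  obtain ⟨b, hb⟩ := g.lorentz x
  have h := hb (b.symm X) (b.symm Y)
  have h' := hb (b.symm Y) (b.symm X)
  rw [b.apply_symm_apply, b.apply_symm_apply] at h h'
  rw [h, h', minkowski_comm]

theorem LorentzMetric.eq_zero (g : LorentzMetric M) (x : M) {X : TangentSpace (𝓡 4) x}
    (hX : ∀ Y, g.form x X Y = 0) : X = 0 := by
  obtain ⟨b, hb⟩ := g.lorentz x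
  have h : b.symm X = 0 := eq_zero_of_minkowski fun Y => by
    rw [← hb, b.apply_symm_apply]; exact hX _
  simpa using h

/-- Nondegeneracy is injectivity into the dual space, which has the same dimension. -/
theorem isInvertible_of_nondegenerate {B : E4 →L[ℝ] E4 →L[ℝ] ℝ}
    (hB : ∀ X, (∀ Y, B X Y = 0) → X = 0) : B.IsInvertible := by
  have hinj : Function.Injective (B : E4 →ₗ[ℝ] E4 →L[ℝ] ℝ) := by
    rw [← LinearMap.ker_eq_bot, LinearMap.ker_eq_bot']
    intro X hX
    refine hB X fun Y => ?_
    have : B X = 0 := hX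
    rw [this, zero_apply]
  have hrank : Module.finrank ℝ E4 = Module.finrank ℝ (E4 →L[ℝ] ℝ) := by
    rw [← (LinearMap.toContinuousLinearMap : (E4 →ₗ[ℝ] ℝ) ≃ₗ[ℝ] E4 →L[ℝ] ℝ).finrank_eq]
    exact Subspace.dual_finrank_eq.symm
  exact ⟨(LinearEquiv.ofInjectiveOfFinrankEq _ hinj hrank).toContinuousLinearEquiv, rfl⟩

theorem mdifferentiable_of_mem_maximalAtlas {φ : OpenPartialHomeomorph M E4}
    (hφ : φ ∈ IsManifold.maximalAtlas (𝓡 4) ∞ M) : φ.MDifferentiable (𝓡 4) (𝓡 4) :=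
  ⟨(contMDiffOn_of_mem_maximalAtlas hφ).mdifferentiableOn (by simp),
    (contMDiffOn_symm_of_mem_maximalAtlas hφ).mdifferentiableOn (by simp)⟩

theorem LorentzMetric.isInvertible_formInChart (g : LorentzMetric M)
    {φ : OpenPartialHomeomorph M E4} (hφ : φ ∈ IsManifold.maximalAtlas (𝓡 4) ∞ M) {y : E4}
    (hy : y ∈ φ.target) : (formInChart g.form φ y).IsInvertible := by
  have hd := (mdifferentiable_of_mem_maximalAtlas hφ).symm
  refine isInvertible_of_nondegenerate fun X hX => ?_
  have h0 : mfderiv (𝓡 4) (𝓡 4) φ.symm y X = 0 := g.eq_zero _ fun Z => by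
    obtain ⟨Y, rfl⟩ := hd.mfderiv_surjective hy Z
    exact hX Y
  exact hd.mfderiv_injective hy
    (h0.trans (ContinuousLinearMap.map_zero (mfderiv (𝓡 4) (𝓡 4) φ.symm y)).symm)

/-- The whole curve stays in one chart, which serves at every parameter. By the chain rule its
velocity is the image of `q` under the derivative of `φ.symm`. -/
theorem isLorentzGeodesic_and_isTimelike (g : LorentzMetric M) {φ : OpenPartialHomeomorph M E4}
    (hφ : φ ∈ IsManifold.maximalAtlas (𝓡 4) ∞ M) {T : ℝ} (hT : 0 < T) {p q : ℝ → E4}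
    (hpO : ∀ t ∈ Icc 0 T, p t ∈ φ.target)
    (hp : ∀ t ∈ Icc 0 T, SolvesGeodesicEq (christoffel (formInChart g.form φ)) (Icc 0 T) p q t)
    (hq : ∀ t ∈ Icc 0 T, formInChart g.form φ (p t) (q t) (q t) < 0) :
    IsLorentzGeodesic g T (fun t => φ.symm (p t)) ∧ IsTimelike g T fun t => φ.symm (p t) := by
  have hpc : ContinuousOn p (Icc 0 T) := fun t ht => (hp t ht).1.continuousWithinAt
  refine ⟨⟨φ.continuousOn_symm.comp hpc hpO, fun t₀ ht₀ => ⟨φ, hφ, φ.map_target (hpO t₀ ht₀), q, ?_⟩⟩,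
    fun t ht => ?_⟩
  · filter_upwards [self_mem_nhdsWithin] with t ht
    have heq : ∀ s ∈ Icc 0 T, φ (φ.symm (p s)) = p s := fun s hs => φ.right_inv (hpO s hs)
    refine ⟨(hp t ht).1.congr heq (heq t ht), ?_⟩
    beta_reduce
    rw [heq t ht]
    exact (hp t ht).2
  · have hd := ((mdifferentiable_of_mem_maximalAtlas hφ).mdifferentiableAt_symm
      (hpO t ht)).hasMFDerivAt
    have h1 : HasMFDerivWithinAt 𝓘(ℝ, ℝ) (𝓡 4) p (Icc 0 T) t
        (ContinuousLinearMap.toSpanSingleton ℝ (q t)) :=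
      (hp t ht).1.hasFDerivWithinAt.hasMFDerivWithinAt
    have h2 := (hd.comp_hasMFDerivWithinAt t h1).mfderivWithin
      (uniqueDiffOn_Icc hT t ht).uniqueMDiffWithinAt
    have h3 : velocity T (fun t => φ.symm (p t)) t = mfderiv (𝓡 4) (𝓡 4) φ.symm (p t) (q t) := by
      have h4 := congrArg (fun A : ℝ →L[ℝ] E4 => A 1) h2
      refine h4.trans ?_
      change mfderiv (𝓡 4) (𝓡 4) φ.symm (p t) ((1 : ℝ) • q t) = _
      rw [one_smul]
    rw [h3]
    exact hq t ht

end Manifold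

end

/-! ### The theorem on the manifold -/

theorem mainTheorem2 {M : Type*} [TopologicalSpace M] [T2Space M] [ChartedSpace E4 M]
    [IsManifold (𝓡 4) ∞ M] (g : LorentzMetric M) (F : ReferenceFrame g)
    (h : FormField) (hh : IsRiemannianMetric h)
    (Γ : ConnectionField) (hΓ : ContDiff ℝ ∞ Γ) (hΓh : IsMetricConnection Γ h)
    (m₀ m₁ : M) (hm₀ : m₀ ∈ F.chart.source) (hm₁ : m₁ ∈ F.chart.source)
    (T : ℝ) (hT : 0 < T) (γ γ' : ℝ → E4) (hγ : IsFrameGeodesic Γ T γ γ')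
    (hγO : ∀ t ∈ Icc 0 T, γ t ∈ F.chart.target)
    (hγ₀ : γ 0 = F.chart m₀) (hγ₁ : γ T = F.chart m₁)
    (hconj : NotConjugateAlong Γ T γ γ')
    (hcone : F.metric (F.chart m₀) (γ' 0) (γ' 0) < 0) :
    (∀ U : Set E4, IsOpen U → (∀ t ∈ Icc 0 T, γ t ∈ U) →
      ∃ (ε C : ℝ) (W : Set E4) (κ : C(Icc (0 : ℝ) 1, E4) → E4),
        IsAdmissible Γ F.metric h (F.chart m₀) (F.chart m₁) (T • γ' 0) ε C W κ ∧
        DevelopmentsIn Γ h (F.chart m₀) ε κ U) ∧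
    ∀ (ε C : ℝ) (W : Set E4) (κ : C(Icc (0 : ℝ) 1, E4) → E4),
      IsAdmissible Γ F.metric h (F.chart m₀) (F.chart m₁) (T • γ' 0) ε C W κ →
      ∀ V : Set E4, V ⊆ F.chart.target → DevelopmentsIn Γ h (F.chart m₀) ε κ V →
        (∀ x ∈ V, gravNorm Γ F.metric h x < ε / (ε + C) ^ 2) →
        ∃ c : ℝ → M, IsLorentzGeodesic g T c ∧ IsTimelike g T c ∧ c 0 = m₀ ∧ c T = m₁ := by

  have hT1 : T⁻¹ * T = 1 := inv_mul_cancel₀ hT.ne'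
  have hcont : ContDiffOn ℝ ∞ F.metric F.chart.target := g.smooth F.chart F.chart_mem
  refine ⟨fun U hU hγU => ?_, fun ε C W κ hκ V hVO hV hG => ?_⟩
  -- On `[0, 1]` the initial velocity is `T • γ' 0`; its square is multiplied by `T²` and stays
  -- negative.
  · have := (hγ.comp_mul hT).exists_isAdmissible (g := F.metric) hΓ hh (hconj.comp_mul hT) (by
      simp only [mul_zero, hγ₀, map_smul, smul_apply, smul_eq_mul, ← mul_assoc]
      exact mul_neg_of_pos_of_neg (mul_pos hT hT) hcone) hU
      (fun t ht => hγU _ (mapsTo_mul_Icc hT.le (mul_one T) ht))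
    simpa only [mul_zero, mul_one, hγ₀, hγ₁] using this
  · obtain ⟨p, q, hp0, hp1, hpq⟩ := hκ.exists_geodesic hΓ hh hΓh F.chart.open_target hcont
      (fun x hx => g.isInvertible_formInChart F.chart_mem hx)
      (fun x hx X Y => g.symm _ _ _) hVO hV hG
    have hmaps := mapsTo_mul_Icc (inv_nonneg.2 hT.le) hT1
    -- The geodesic found on `[0, 1]` is slowed down to `[0, T]` and carried to `M` by the inverse
    -- chart.
    have hgt := isLorentzGeodesic_and_isTimelike g F.chart_mem hT (p := fun t => p (T⁻¹ * t))
      (q := fun t => T⁻¹ • q (T⁻¹ * t)) (fun t ht => (hpq _ (hmaps ht)).1)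
      (fun t ht => (hpq _ (hmaps ht)).2.1.comp_mul (christoffel_smul _) hmaps)
      (fun t ht => by
        have h1 := (hpq _ (hmaps ht)).2.2
        simp only [map_smul, smul_apply, smul_eq_mul, ← mul_assoc]
        exact mul_neg_of_pos_of_neg (mul_pos (inv_pos.2 hT) (inv_pos.2 hT)) h1)
    refine ⟨_, hgt.1, hgt.2, ?_, ?_⟩
    · simp only [mul_zero, hp0]
      exact F.chart.left_inv hm₀
    · simp only [hT1, hp1]
      exact F.chart.left_inv hm₁
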